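/- **Setting.** Let $A_0=\mathbb C\subseteq A_1\subseteq A_2\subseteq\cdots$ be atomic $W^*$-algebras with separable preduals, with unital normal inclusions. Thus $A_n=\bigoplus^{\ell^\infty}_{z\in\mathfrak Z_n}zA_n$ with $zA_n=B(\mathcal H_z)$, where $\mathfrak Z_n$ is the countable set of minimal projections of the center $\mathcal Z(A_n)$ and each $\mathcal H_z$ is a nonzero separable Hilbert space. Let $\alpha^t$ be a flow on the inductive limit $C^*$-algebra with $\alpha^t(A_n)=A_n$ whose restriction $\alpha^t_n$ to each $A_n$ is continuous in the $u$-topology, i.e. $t\mapsto\varphi\circ\alpha_n^t$ is norm continuous for each normal functional $\varphi$ on $A_n$; write $\alpha^t_z$ for the restriction to $zA_n$. Let $\beta\in\mathbb R$ be such that there is a unique normal $(\alpha^t_z,\beta)$-KMS state $\tau_z$ on $zA_n$ for all $n$ and $z\in\mathfrak Z_n$. Put $$E_n(a)=\sum_{z\in\mathfrak Z_n}\tau_z(za)\,z\quad(a\in A_n),\qquad \Theta_{n+1,n}=E_{n+1}|_{\mathcal Z(A_n)}\colon\mathcal Z(A_n)\to\mathcal Z(A_{n+1}),$$ and $\Theta_{m,n}=\Theta_{m,m-1}\circ\cdots\circ\Theta_{n+1,n}$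 for $m>n$. Let $\ddot{\mathcal S}=\ddot{\mathcal S}(\alpha^t,\beta)$ be the inductive limit of $\mathcal Z(A_0)\to\mathcal Z(A_1)\to\cdots$ along the maps $\Theta_{n+1,n}$ in the category of matrix ordered $*$-vector spaces with matrix order unit, with canonical maps $\ddot\Theta_{\infty,n}\colon\mathcal Z(A_n)\to\ddot{\mathcal S}$ and order unit $\ddot e$: its vector space is the algebraic inductive limit, and the positive cone of $\mathbb M_k(\ddot{\mathcal S})$ consists of the images of the positive elements of the $\mathbb M_k(\mathcal Z(A_n))$, $n\ge0$. Let $q\colon\ddot{\mathcal S}\to\mathcal S=\mathcal S(\alpha^t,\beta)$ be its Archimedeanization: the kernel of $q$ is the common kernel of all states of $\ddot{\mathcal S}$, and $X\in\mathbb M_k(\mathcal S)$ is positive if and only if, for every $r>0$, $X+r\,(e\otimes 1_k)$ is the image of a positive element of $\mathbb M_k(\ddot{\mathcal S})$, where $e=q(\ddot e)$. Put $\Theta_{\infty,n}=q\circ\ddot\Theta_{\infty,n}$. The operator system $\mathcal S$ carries the norm $$\|s\|=\inf\Big\{r>0:\begin{bmatrix} r e& s\\ s^*& r e\end{bmatrix}\ge0\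 \text{in}\ \mathbb M_2(\mathcal S)\Big\}.$$ Suppose that a left multiplicative structure is given: normal injective $*$-homomorphisms $\iota_{m,n}\colon A_m\bar\otimes A_n\to A_{m+n}$ ($m,n\ge0$) such that * (m1) $\iota_{0,n}$ and $\iota_{m,0}$ are the natural maps $\mathbb C\otimes A_n\cong A_n$ and $A_m\otimes\mathbb C\cong A_m$; * (m2) $\iota_{\ell+m,n}\circ(\iota_{\ell,m}\bar\otimes\mathrm{id})=\iota_{\ell,m+n}\circ(\mathrm{id}\,\bar\otimes\,\iota_{m,n})$; * (m3) $\iota_{m,n}\circ(\alpha_m^t\bar\otimes\alpha_n^t)=\alpha_{m+n}^t\circ\iota_{m,n}$; * (L) the inclusion $A_n\hookrightarrow A_{n+1}$ is $a\mapsto\iota_{n,1}(a\otimes1)$. On $\Sigma=\Sigma(\alpha^t,\beta)=\bigoplus_{n\ge0}\mathcal Z(A_n)$ (algebraic direct sum) consider the bilinear multiplication with $f\cdot g=E_{m+n}(\iota_{m,n}(f\otimes g))\in\mathcal Z(A_{m+n})$ for $f\in\mathcal Z(A_m)$, $g\in\mathcal Z(A_n)$, and let $1_0\in\Sigma$ be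 the unit of $\mathcal Z(A_0)$. **Proposition 3.16.** Assume that the left multiplicative structure has property (c): for all $m,n\ge0$ there are $*$-automorphisms $\gamma_{m+n}^{(m,n)}$ of $A_{m+n}$, $\gamma_m^{(m,n)}$ of $A_m$ and $\gamma_n^{(m,n)}$ of $A_n$ that act trivially on the centers, such that $$\gamma_{m+n}^{(m,n)}(\iota_{m,n}(a\otimes b))=\iota_{n,m}\big(\gamma_n^{(m,n)}(b)\otimes\gamma_m^{(m,n)}(a)\big)\quad(a\in A_m,\ b\in A_n)$$ and such that $\gamma_{m+n}^{(m,n)}$ commutes with $\alpha_{m+n}^t$ for every $t\in\mathbb R$. Then the following hold. 1. $\Sigma$ is a unital commutative (associative) algebra over $\mathbb C$ with unit $1_0$. 2. The formulas $f\cdot\ddot\Theta_{\infty,n}(g)=\ddot\Theta_{\infty,m+n}(E_{m+n}(\iota_{m,n}(f\otimes g)))$ and $f\cdot\Theta_{\infty,n}(g)=\Theta_{\infty,m+n}(E_{m+n}(\iota_{m,n}(f\otimes g)))$, for $f\in\mathcal Z(A_m)$, $g\in\mathcal Z(A_n)$, define left $\Sigma$-module structures on $\ddot{\mathcal S}$ and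 on $\mathcal S$. There are multiplications that make $\ddot{\mathcal S}$ and $\mathcal S$ unital commutative (associative) algebras over $\mathbb C$ with units $\ddot e$ and $e$, respectively, and for which the maps $\Sigma\to\ddot{\mathcal S}$, $x\mapsto x\cdot\ddot e$, and $\Sigma\to\mathcal S$, $x\mapsto x\cdot e$, are surjective homomorphisms of unital algebras. 3. With this multiplication and the operator system norm, $\mathcal S$ is a normed algebra: $\|\cdot\|$ is a norm on $\mathcal S$ with $\|st\|\le\|s\|\,\|t\|$ for all $s,t\in\mathcal S$, and $\|e\|=1$. -/

import Mathlib

open scoped ENNReal TensorProduct ComplexOrder DirectSum InnerProductSpace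

universe u v

noncomputable section

namespace RepSystem

/-! ## Atomic W*-algebras -/

/-- An atomic `W*`-algebra, given by the set `Z` of the minimal projections of its center and, for
each `z : Z`, the (nonzero) Hilbert space `H z` with `z A = B(H z)`.  The algebra itself is
`AtomicAlg.Op`, the `ℓ^∞`-direct sum of the `B(H z)`; every atomic `W*`-algebra is of this form up to
a `*`-isomorphism, and `*`-isomorphisms of `W*`-algebras are normal. -/
structure AtomicAlg where
  Z : Type u
  H : Z → Type v
  [normedAddCommGroup : ∀ z, NormedAddCommGroup (H z)]
  [innerProductSpace : ∀ z, InnerProductSpace ℂ (H z)]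
  [completeSpace : ∀ z, CompleteSpace (H z)]
  [nontrivial : ∀ z, Nontrivial (H z)]

attribute [instance] AtomicAlg.normedAddCommGroup AtomicAlg.innerProductSpace
  AtomicAlg.completeSpace AtomicAlg.nontrivial

namespace AtomicAlg

/-- The underlying `C*`-algebra: bounded families `(a z)` with `a z ∈ B(H z)`, with the supremum
norm and componentwise operations. -/
def Op (A : AtomicAlg.{u, v}) : Type (max u v) :=
  lp (fun z : A.Z => A.H z →L[ℂ] A.H z) ∞

section Instances

variable (A : AtomicAlg.{u, v})

instance : NormedRing A.Op :=
  (lp.inftyNormedRing : NormedRing (lp (fun z : A.Z => A.H z →L[ℂ] A.H z) ∞))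

instance : StarRing A.Op :=
  (lp.inftyStarRing : StarRing (lp (fun z : A.Z => A.H z →L[ℂ] A.H z) ∞))

instance : NormedAlgebra ℂ A.Op :=
  (lp.inftyNormedAlgebra : NormedAlgebra ℂ (lp (fun z : A.Z => A.H z →L[ℂ] A.H z) ∞))

instance : StarModule ℂ A.Op :=
  (inferInstance : StarModule ℂ (lp (fun z : A.Z => A.H z →L[ℂ] A.H z) ∞))

instance : CompleteSpace A.Op :=
  (inferInstance : CompleteSpace (lp (fun z : A.Z => A.H z →L[ℂ] A.H z) ∞))

instance : CStarRing A.Op :=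
  (lp.inftyCStarRing : CStarRing (lp (fun z : A.Z => A.H z →L[ℂ] A.H z) ∞))

instance : CStarAlgebra A.Op :=
  { (inferInstance : NormedRing A.Op), (inferInstance : StarRing A.Op),
    (inferInstance : CompleteSpace A.Op), (inferInstance : CStarRing A.Op),
    (inferInstance : NormedAlgebra ℂ A.Op), (inferInstance : StarModule ℂ A.Op) with }

end Instances

/-- The component `z a ∈ z A = B(H z)` of `a ∈ A`. -/
def comp {A : AtomicAlg.{u, v}} (z : A.Z) (a : A.Op) : A.H z →L[ℂ] A.H z := a.1 z

/-- The element of `A` with components `f z`, for a bounded family `f`. -/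
def ofFamily {A : AtomicAlg.{u, v}} (f : ∀ z, A.H z →L[ℂ] A.H z) (C : ℝ) (hf : ∀ z, ‖f z‖ ≤ C) :
    A.Op :=
  ⟨f, memℓp_infty ⟨C, by rintro _ ⟨z, rfl⟩; exact hf z⟩⟩

section Components

variable {A : AtomicAlg.{u, v}}

lemma op_ext {a b : A.Op} (h : ∀ z, comp z a = comp z b) : a = b := lp.ext (funext h)

lemma norm_comp_le (z : A.Z) (a : A.Op) : ‖comp z a‖ ≤ ‖a‖ :=
  lp.norm_apply_le_norm ENNReal.top_ne_zero a z

lemma comp_ofFamily (f : ∀ z, A.H z →L[ℂ] A.H z) (C : ℝ) (hf : ∀ z, ‖f z‖ ≤ C) (z : A.Z) :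
    comp z (ofFamily f C hf) = f z := rfl

lemma comp_add (z : A.Z) (a b : A.Op) : comp z (a + b) = comp z a + comp z b := rfl

lemma comp_smul (z : A.Z) (c : ℂ) (a : A.Op) : comp z (c • a) = c • comp z a := rfl

lemma comp_mul (z : A.Z) (a b : A.Op) : comp z (a * b) = comp z a * comp z b := rfl

lemma comp_star (z : A.Z) (a : A.Op) : comp z (star a) = star (comp z a) := rfl

lemma comp_one (z : A.Z) : comp z (1 : A.Op) = 1 := rfl

end Components

open Classical in
/-- The embedding of the summand `z A = B(H z)` into `A`. -/
def block {A : AtomicAlg.{u, v}} (z : A.Z) (x : A.H z →L[ℂ] A.H z) : A.Op :=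
  ofFamily (Pi.single z x) ‖x‖ fun w => by
    by_cases h : w = z
    · subst h; simp
    · simp [h]

/-- The center `𝒵(A)`. -/
def Center (A : AtomicAlg.{u, v}) : Type (max u v) := Subalgebra.center ℂ A.Op

section Instances

variable (A : AtomicAlg.{u, v})

instance : CommRing A.Center := (inferInstance : CommRing (Subalgebra.center ℂ A.Op))

instance : Algebra ℂ A.Center := (inferInstance : Algebra ℂ (Subalgebra.center ℂ A.Op))

instance : StarRing A.Center where
  star a := ⟨star a.1, Set.star_mem_center a.2⟩
  star_involutive a := Subtype.ext (star_star a.1)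
  star_mul a b := Subtype.ext (star_mul a.1 b.1)
  star_add a b := Subtype.ext (star_add a.1 b.1)

instance : StarModule ℂ A.Center where
  star_smul c a := Subtype.ext (star_smul c a.1)

end Instances

/-- The inclusion of the center. -/
def centerIncl (A : AtomicAlg.{u, v}) : A.Center →⋆ₐ[ℂ] A.Op :=
  { (Subalgebra.center ℂ A.Op).val with map_star' := fun _ => rfl }

lemma centerIncl_injective (A : AtomicAlg.{u, v}) : Function.Injective A.centerIncl :=
  Subtype.val_injective

/-- The separability of the predual `⊕^{ℓ¹} B(H z)_*`. -/
def SeparablePredual (A : AtomicAlg.{u, v}) : Prop :=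
  Countable A.Z ∧ ∀ z, TopologicalSpace.SeparableSpace (A.H z)

/-- Normal (that is, `σ`-weakly continuous) functionals: those of the form
`a ↦ ∑ₖ ⟨ξₖ, aₖ ηₖ⟩` with `∑ₖ ‖ξₖ‖ ‖ηₖ‖ < ∞`. -/
def IsNormalFunctional (A : AtomicAlg.{u, v}) (φ : A.Op →ₗ[ℂ] ℂ) : Prop :=
  ∃ (z : ℕ → A.Z) (ξ η : ∀ k, A.H (z k)), Summable (fun k => ‖ξ k‖ * ‖η k‖) ∧
    ∀ a : A.Op, HasSum (fun k => inner ℂ (ξ k) (comp (z k) a (η k))) (φ a)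

/-- Normal linear maps: those that pull normal functionals back to normal functionals. -/
def IsNormalMap {A B : AtomicAlg.{u, v}} (T : A.Op →ₗ[ℂ] B.Op) : Prop :=
  ∀ φ : B.Op →ₗ[ℂ] ℂ, B.IsNormalFunctional φ → A.IsNormalFunctional (φ ∘ₗ T)

open UniformSpace in
instance (E K : Type v) [NormedAddCommGroup E] [InnerProductSpace ℂ E] [Nontrivial E]
    [NormedAddCommGroup K] [InnerProductSpace ℂ K] [Nontrivial K] :
    Nontrivial (Completion (E ⊗[ℂ] K)) := by
  obtain ⟨x, hx⟩ := exists_ne (0 : E)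
  obtain ⟨y, hy⟩ := exists_ne (0 : K)
  refine ⟨((x ⊗ₜ[ℂ] y : E ⊗[ℂ] K) : Completion (E ⊗[ℂ] K)), 0, fun h => ?_⟩
  have h1 : ‖((x ⊗ₜ[ℂ] y : E ⊗[ℂ] K) : Completion (E ⊗[ℂ] K))‖ = 0 := by rw [h, norm_zero]
  rw [Completion.norm_coe, TensorProduct.norm_tmul] at h1
  simp [hx, hy] at h1

/-- The von Neumann algebra tensor product `A ⊗̄ B`; its blocks are
`B(H z) ⊗̄ B(K w) = B(H z ⊗ K w)`, with the Hilbert space tensor product. -/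
@[reducible] def tensor (A B : AtomicAlg.{u, v}) : AtomicAlg.{u, v} where
  Z := A.Z × B.Z
  H := fun p => UniformSpace.Completion (A.H p.1 ⊗[ℂ] B.H p.2)

/-- The operator `x ⊗ y` on the Hilbert space tensor product. -/
def opTensor {E K : Type v} [NormedAddCommGroup E] [InnerProductSpace ℂ E]
    [NormedAddCommGroup K] [InnerProductSpace ℂ K] (x : E →L[ℂ] E) (y : K →L[ℂ] K) :
    UniformSpace.Completion (E ⊗[ℂ] K) →L[ℂ] UniformSpace.Completion (E ⊗[ℂ] K) :=
  (TensorProduct.mapL x y).completion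

lemma norm_opTensor_le {E K : Type v} [NormedAddCommGroup E] [InnerProductSpace ℂ E]
    [NormedAddCommGroup K] [InnerProductSpace ℂ K] (x : E →L[ℂ] E) (y : K →L[ℂ] K) :
    ‖opTensor x y‖ ≤ ‖x‖ * ‖y‖ := by
  refine ContinuousLinearMap.opNorm_le_bound _ (by positivity) fun w => ?_
  induction w using UniformSpace.Completion.induction_on with
  | hp => exact isClosed_le (by fun_prop) (by fun_prop)
  | ih w =>
    rw [opTensor, ContinuousLinearMap.completion_apply_coe, UniformSpace.Completion.norm_coe,
      UniformSpace.Completion.norm_coe]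
    exact (ContinuousLinearMap.le_opNorm _ _).trans
      (mul_le_mul_of_nonneg_right (TensorProduct.norm_mapL_le x y) (norm_nonneg _))

lemma opTensor_ext {E K : Type v} [NormedAddCommGroup E] [InnerProductSpace ℂ E]
    [NormedAddCommGroup K] [InnerProductSpace ℂ K]
    {S T : UniformSpace.Completion (E ⊗[ℂ] K) →L[ℂ] UniformSpace.Completion (E ⊗[ℂ] K)}
    (h : ∀ (e : E) (k : K), S ((e ⊗ₜ[ℂ] k : E ⊗[ℂ] K) : UniformSpace.Completion (E ⊗[ℂ] K)) =
      T ((e ⊗ₜ[ℂ] k : E ⊗[ℂ] K) : UniformSpace.Completion (E ⊗[ℂ] K))) : S = T := by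
  ext w
  induction w using UniformSpace.Completion.induction_on with
  | hp => exact isClosed_eq (by fun_prop) (by fun_prop)
  | ih w =>
    induction w using TensorProduct.induction_on with
    | zero => rw [UniformSpace.Completion.coe_zero, map_zero, map_zero]
    | tmul e k => exact h e k
    | add a b ha hb => simp only [UniformSpace.Completion.coe_add, map_add, ha, hb]

lemma opTensor_tmul {E K : Type v} [NormedAddCommGroup E] [InnerProductSpace ℂ E]
    [NormedAddCommGroup K] [InnerProductSpace ℂ K] (x : E →L[ℂ] E) (y : K →L[ℂ] K)
    (e : E) (k : K) :
    opTensor x y ((e ⊗ₜ[ℂ] k : E ⊗[ℂ] K) : UniformSpace.Completion (E ⊗[ℂ] K)) =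
      ((x e ⊗ₜ[ℂ] y k : E ⊗[ℂ] K) : UniformSpace.Completion (E ⊗[ℂ] K)) := by
  rw [opTensor, ContinuousLinearMap.completion_apply_coe, TensorProduct.mapL_tmul]

/-- The bilinear map `(a, b) ↦ a ⊗ b` from `A × B` to `A ⊗̄ B`, where `a ⊗ b` has the components
`a_z ⊗ b_w`. -/
def tmul (A B : AtomicAlg.{u, v}) : A.Op →ₗ[ℂ] B.Op →ₗ[ℂ] (A.tensor B).Op :=
  LinearMap.mk₂ ℂ
    (fun a b => ofFamily (A := A.tensor B) (fun p => opTensor (comp p.1 a) (comp p.2 b))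
      (‖a‖ * ‖b‖) fun p => (norm_opTensor_le _ _).trans
        (mul_le_mul (norm_comp_le p.1 a) (norm_comp_le p.2 b) (norm_nonneg _) (norm_nonneg _)))
    (fun a a' b => op_ext fun p => opTensor_ext fun e k => by
      simp only [comp_ofFamily, comp_add, opTensor_tmul, add_apply, TensorProduct.add_tmul,
        UniformSpace.Completion.coe_add])
    (fun c a b => op_ext fun p => opTensor_ext fun e k => by
      simp only [comp_ofFamily, comp_smul, opTensor_tmul, smul_apply,
        ← TensorProduct.smul_tmul', UniformSpace.Completion.coe_smul])
    (fun a b b' => op_ext fun p => opTensor_ext fun e k => by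
      simp only [comp_ofFamily, comp_add, opTensor_tmul, add_apply, TensorProduct.tmul_add,
        UniformSpace.Completion.coe_add])
    (fun c a b => op_ext fun p => opTensor_ext fun e k => by
      simp only [comp_ofFamily, comp_smul, opTensor_tmul, smul_apply, TensorProduct.tmul_smul,
        UniformSpace.Completion.coe_smul])

end AtomicAlg

/-! ## Normal KMS states on `B(E)` -/

section KMS

variable {E : Type v} [NormedAddCommGroup E] [InnerProductSpace ℂ E] [CompleteSpace E]

/-- Normal functionals on `B(E)`: those of the form `x ↦ ∑ₖ ⟨ξₖ, x ηₖ⟩` with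
`∑ₖ ‖ξₖ‖ ‖ηₖ‖ < ∞`. -/
def IsNormal (τ : (E →L[ℂ] E) →ₗ[ℂ] ℂ) : Prop :=
  ∃ ξ η : ℕ → E, Summable (fun k => ‖ξ k‖ * ‖η k‖) ∧
    ∀ x : E →L[ℂ] E, HasSum (fun k => inner ℂ (ξ k) (x (η k))) (τ x)

/-- States on `B(E)`: positive unital functionals. -/
def IsState (τ : (E →L[ℂ] E) →ₗ[ℂ] ℂ) : Prop :=
  τ 1 = 1 ∧ ∀ x : E →L[ℂ] E, 0 ≤ τ (star x * x)

/-- The `(σ, β)`-KMS condition: for all `a, b` there is a function `F`, bounded and continuous on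
the closed horizontal strip between the lines `Im w = 0` and `Im w = β`, holomorphic in its
interior, with `F(t) = τ(a σ_t(b))` and `F(t + iβ) = τ(σ_t(b) a)` for all real `t`. -/
def IsKMS (σ : ℝ → (E →L[ℂ] E) → (E →L[ℂ] E)) (β : ℝ) (τ : (E →L[ℂ] E) →ₗ[ℂ] ℂ) : Prop :=
  ∀ a b : E →L[ℂ] E, ∃ F : ℂ → ℂ,
    ContinuousOn F {w : ℂ | min 0 β ≤ w.im ∧ w.im ≤ max 0 β} ∧
    (∃ C : ℝ, ∀ w : ℂ, min 0 β ≤ w.im → w.im ≤ max 0 β → ‖F w‖ ≤ C) ∧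
    DifferentiableOn ℂ F {w : ℂ | min 0 β < w.im ∧ w.im < max 0 β} ∧
    ∀ t : ℝ, F t = τ (a * σ t b) ∧ F (t + β * Complex.I) = τ (σ t b * a)

/-- Normal `(σ, β)`-KMS states. -/
def IsNormalKMSState (σ : ℝ → (E →L[ℂ] E) → (E →L[ℂ] E)) (β : ℝ)
    (τ : (E →L[ℂ] E) →ₗ[ℂ] ℂ) : Prop :=
  IsNormal τ ∧ IsState τ ∧ IsKMS σ β τ

lemma IsState.map_star {τ : (E →L[ℂ] E) →ₗ[ℂ] ℂ} (h : IsState τ) (x : E →L[ℂ] E) :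
    τ (star x) = star (τ x) := by
  have h0 := (Complex.le_def.1 (h.2 x)).2
  have h1 := (Complex.le_def.1 (h.2 (1 + x))).2
  have h2 := (Complex.le_def.1 (h.2 (1 + Complex.I • x))).2
  simp only [star_add, star_one, star_smul, add_mul, mul_add, one_mul, mul_one, smul_mul_assoc,
    mul_smul_comm, map_add, map_smul, h.1, smul_eq_mul, Complex.add_im, Complex.mul_im,
    Complex.star_def, Complex.conj_I, Complex.neg_re, Complex.neg_im, Complex.I_re, Complex.I_im,
    Complex.zero_im, Complex.one_im, Complex.mul_re] at h0 h1 h2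
  apply Complex.ext <;> simp only [Complex.star_def, Complex.conj_re, Complex.conj_im] <;> linarith

lemma IsState.norm_le {τ : (E →L[ℂ] E) →ₗ[ℂ] ℂ} (h : IsState τ) (x : E →L[ℂ] E) :
    ‖τ x‖ ≤ ‖x‖ := by
  have h1 : 0 ≤ τ (algebraMap ℝ (E →L[ℂ] E) (‖x‖ ^ 2) - star x * x) := by
    obtain ⟨y, hy⟩ := CStarAlgebra.nonneg_iff_eq_star_mul_self.1
      (sub_nonneg.2 (CStarAlgebra.star_mul_le_algebraMap_norm_sq (a := x)))
    rw [hy]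
    exact h.2 y
  have h2 := h.2 (x - τ x • 1)
  have h3 : algebraMap ℝ (E →L[ℂ] E) (‖x‖ ^ 2) = ((‖x‖ ^ 2 : ℝ) : ℂ) • 1 := by
    rw [Algebra.algebraMap_eq_smul_one, Complex.coe_smul]
  rw [h3, map_sub, map_smul, h.1] at h1
  simp only [star_sub, star_smul, star_one, sub_mul, mul_sub, smul_mul_assoc, mul_smul_comm,
    one_mul, mul_one, map_sub, map_smul, h.1, h.map_star, smul_eq_mul] at h2
  have h1' := (Complex.le_def.1 h1).1
  have h2' := (Complex.le_def.1 h2).1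
  have h4 : ‖τ x‖ ^ 2 ≤ ‖x‖ ^ 2 := by
    rw [← Complex.normSq_eq_norm_sq (τ x), Complex.normSq_apply]
    simp at h1' h2'
    have h5 : ((‖x‖ : ℂ) ^ 2).re = ‖x‖ ^ 2 := by norm_cast
    nlinarith
  exact le_of_sq_le_sq h4 (norm_nonneg _)

end KMS

/-! ## Inductive sequences of atomic `W*`-algebras with a flow -/

/-- An inductive sequence `A 0 = ℂ ⊆ A 1 ⊆ A 2 ⊆ ⋯` of atomic `W*`-algebras with separable
preduals and unital normal inclusions, together with a flow on the inductive limit `C*`-algebra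
that leaves each `A n` globally invariant and restricts to a flow on `A n` that is continuous in
the `u`-topology.  As the union of the `A n` is dense in the inductive limit, such a flow is the
same thing as the compatible family `α n` of its restrictions. -/
structure FlowSequence where
  A : ℕ → AtomicAlg.{u, v}
  separable : ∀ n, (A n).SeparablePredual
  zero_eq_complex : Function.Bijective (algebraMap ℂ (A 0).Op)
  incl : ∀ n, (A n).Op →⋆ₐ[ℂ] (A (n + 1)).Op
  incl_injective : ∀ n, Function.Injective (incl n)
  incl_normal : ∀ n, AtomicAlg.IsNormalMap (incl n).toAlgHom.toLinearMap
  α : ∀ n, ℝ → ((A n).Op ≃⋆ₐ[ℂ] (A n).Op)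
  α_zero : ∀ n a, α n 0 a = a
  α_add : ∀ n s t a, α n (s + t) a = α n s (α n t a)
  α_incl : ∀ n t a, incl n (α n t a) = α (n + 1) t (incl n a)
  /-- For each normal functional `φ`, the map `t ↦ φ ∘ α n t` is norm continuous. -/
  α_continuous : ∀ n (φ : (A n).Op →ₗ[ℂ] ℂ), (A n).IsNormalFunctional φ →
    ∀ (s : ℝ) (ε : ℝ), 0 < ε → ∀ᶠ t in nhds s, ∀ a, ‖φ (α n t a) - φ (α n s a)‖ ≤ ε * ‖a‖

namespace FlowSequence

variable (S : FlowSequence.{u, v})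

/-- The algebra `A n`. -/
abbrev Alg (n : ℕ) : Type (max u v) := (S.A n).Op

/-- The center `𝒵(A n)`. -/
abbrev Zc (n : ℕ) : Type (max u v) := (S.A n).Center

/-- The restriction of the flow to `z A n = B(H z)`. -/
def blockFlow (n : ℕ) (z : (S.A n).Z) (t : ℝ) (x : (S.A n).H z →L[ℂ] (S.A n).H z) :
    (S.A n).H z →L[ℂ] (S.A n).H z :=
  AtomicAlg.comp z (S.α n t (AtomicAlg.block z x))

/-- The standing requirement on the inverse temperature `β`: there is a unique normal
`(α_z, β)`-KMS state on each `z A n`. -/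
def Admissible (β : ℝ) : Prop :=
  ∀ n (z : (S.A n).Z), ∃! τ : ((S.A n).H z →L[ℂ] (S.A n).H z) →ₗ[ℂ] ℂ,
    IsNormalKMSState (S.blockFlow n z) β τ

variable {S} {β : ℝ}

namespace Admissible

variable (hβ : S.Admissible β)

/-- The normal KMS state `τ_z` on `z A n`. -/
def τ (n : ℕ) (z : (S.A n).Z) : ((S.A n).H z →L[ℂ] (S.A n).H z) →ₗ[ℂ] ℂ :=
  (hβ n z).choose

lemma τ_spec (n : ℕ) (z : (S.A n).Z) : IsNormalKMSState (S.blockFlow n z) β (hβ.τ n z) :=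
  (hβ n z).choose_spec.1

/-- The conditional expectation `E_n(a) = ∑_z τ_z(z a) z` of `A n` onto its center. -/
def E (n : ℕ) : S.Alg n →ₗ[ℂ] S.Zc n where
  toFun a := ⟨AtomicAlg.ofFamily (fun z => hβ.τ n z (AtomicAlg.comp z a) • 1) ‖a‖ fun z => by
      rw [norm_smul, norm_one, mul_one]
      exact ((hβ.τ_spec n z).2.1.norm_le _).trans (AtomicAlg.norm_comp_le z a), by
    refine Subalgebra.mem_center_iff.2 fun b => AtomicAlg.op_ext fun z => ?_
    rw [AtomicAlg.comp_mul, AtomicAlg.comp_mul, AtomicAlg.comp_ofFamily, mul_smul_comm,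
      smul_mul_assoc, one_mul, mul_one]⟩
  map_add' a b := Subtype.ext (AtomicAlg.op_ext fun z => by
    change hβ.τ n z (AtomicAlg.comp z a + AtomicAlg.comp z b) •
      (1 : (S.A n).H z →L[ℂ] (S.A n).H z) =
      hβ.τ n z (AtomicAlg.comp z a) • 1 + hβ.τ n z (AtomicAlg.comp z b) • 1
    rw [map_add, add_smul])
  map_smul' c a := Subtype.ext (AtomicAlg.op_ext fun z => by
    change hβ.τ n z (c • AtomicAlg.comp z a) • (1 : (S.A n).H z →L[ℂ] (S.A n).H z) =
      c • hβ.τ n z (AtomicAlg.comp z a) • 1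
    rw [map_smul, smul_eq_mul, mul_smul])

lemma E_apply (n : ℕ) (a : S.Alg n) (z : (S.A n).Z) :
    AtomicAlg.comp z ((S.A n).centerIncl (hβ.E n a)) = hβ.τ n z (AtomicAlg.comp z a) • 1 := rfl

lemma E_star (n : ℕ) (a : S.Alg n) : hβ.E n (star a) = star (hβ.E n a) :=
  (S.A n).centerIncl_injective (AtomicAlg.op_ext fun z => by
    rw [E_apply, map_star, AtomicAlg.comp_star, AtomicAlg.comp_star, E_apply,
      (hβ.τ_spec n z).2.1.map_star, star_smul, star_one])

lemma E_one (n : ℕ) : hβ.E n 1 = 1 :=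
  (S.A n).centerIncl_injective (AtomicAlg.op_ext fun z => by
    rw [E_apply, map_one, AtomicAlg.comp_one, (hβ.τ_spec n z).2.1.1, one_smul])

/-! ### The transition maps -/

/-- `Θ_{n+1,n} : 𝒵(A n) → 𝒵(A (n+1))`, the restriction of `E_{n+1}`. -/
def Θsucc (n : ℕ) : S.Zc n →ₗ[ℂ] S.Zc (n + 1) :=
  hβ.E (n + 1) ∘ₗ (S.incl n).toAlgHom.toLinearMap ∘ₗ (S.A n).centerIncl.toAlgHom.toLinearMap

/-- `Θ_{n,m} = Θ_{n,n-1} ∘ ⋯ ∘ Θ_{m+1,m}` for `m ≤ n` (the identity for `n = m`). -/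
def Θ (m n : ℕ) (h : m ≤ n) : S.Zc m →ₗ[ℂ] S.Zc n :=
  Nat.leRec (motive := fun n _ => S.Zc m →ₗ[ℂ] S.Zc n) LinearMap.id
    (fun n _ f => hβ.Θsucc n ∘ₗ f) h

lemma Θ_self (m : ℕ) : hβ.Θ m m le_rfl = LinearMap.id := by
  rw [Θ, Nat.leRec_self]

lemma Θ_succ (m n : ℕ) (h : m ≤ n) (f : S.Zc m) :
    hβ.Θ m (n + 1) (h.trans n.le_succ) f = hβ.Θsucc n (hβ.Θ m n h f) := by
  rw [Θ, Nat.leRec_succ _ _ h]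
  rfl

lemma Θsucc_star (n : ℕ) (f : S.Zc n) : hβ.Θsucc n (star f) = star (hβ.Θsucc n f) := by
  change hβ.E (n + 1) (S.incl n ((S.A n).centerIncl (star f))) = _
  rw [map_star, map_star, hβ.E_star]
  rfl

lemma Θ_star (m n : ℕ) (h : m ≤ n) (f : S.Zc m) : hβ.Θ m n h (star f) = star (hβ.Θ m n h f) := by
  induction n, h using Nat.le_induction with
  | base => rw [Θ_self, LinearMap.id_apply, LinearMap.id_apply]
  | succ n h ih => rw [hβ.Θ_succ m n h, hβ.Θ_succ m n h, ih, hβ.Θsucc_star]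

/-! ### The representation system `S̈(α, β)` -/

/-- The vector space underlying the representation system `S̈(α, β)`: the inductive limit of
`𝒵(A 0) → 𝒵(A 1) → ⋯` along the maps `Θ`. -/
def RepSys : Type (max u v) := Module.DirectLimit (R := ℂ) S.Zc hβ.Θ

instance : AddCommGroup hβ.RepSys :=
  Module.addCommMonoidToAddCommGroup ℂ (M := Module.DirectLimit (R := ℂ) S.Zc hβ.Θ)

instance : Module ℂ hβ.RepSys := Module.DirectLimit.module (R := ℂ) S.Zc hβ.Θ

/-- The canonical maps `Θ̈_{∞,n} : 𝒵(A n) → S̈(α, β)`. -/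
def toRepSys (n : ℕ) : S.Zc n →ₗ[ℂ] hβ.RepSys := Module.DirectLimit.of ℂ ℕ S.Zc hβ.Θ n

/-- The matrix order unit `ë` of `S̈(α, β)`. -/
def unitRepSys : hβ.RepSys := hβ.toRepSys 0 1

lemma toRepSys_Θ (m n : ℕ) (h : m ≤ n) (f : S.Zc m) :
    hβ.toRepSys n (hβ.Θ m n h f) = hβ.toRepSys m f :=
  Module.DirectLimit.of_f (R := ℂ) (G := S.Zc) (f := hβ.Θ)

lemma exists_toRepSys (x : hβ.RepSys) : ∃ n f, hβ.toRepSys n f = x :=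
  Module.DirectLimit.exists_of (R := ℂ) (G := S.Zc) (f := hβ.Θ) x

/-- The additive map `(fₙ)ₙ ↦ ∑ₙ Θ̈_{∞,n} (fₙ^*)` from the direct sum of the `𝒵(A n)`. -/
def starDirectSum : (⨁ n, S.Zc n) →+ hβ.RepSys :=
  DirectSum.toAddMonoid fun n =>
    (hβ.toRepSys n).toAddMonoidHom.comp (starAddEquiv : S.Zc n ≃+ S.Zc n).toAddMonoidHom

lemma starDirectSum_lof (n : ℕ) (f : S.Zc n) :
    hβ.starDirectSum (DirectSum.lof ℂ ℕ S.Zc n f) = hβ.toRepSys n (star f) :=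
  DirectSum.toAddMonoid_of _ _ _

/-- The involution of `S̈(α, β)` as an additive map. -/
def starRepSysAux : hβ.RepSys →+ hβ.RepSys :=
  AddCon.lift (Module.DirectLimit.moduleCon hβ.Θ).toAddCon hβ.starDirectSum
    (AddCon.addConGen_le.2 fun _ _ ⟨h, x⟩ => by
      change hβ.starDirectSum _ = hβ.starDirectSum _
      rw [starDirectSum_lof, starDirectSum_lof]
      exact (hβ.toRepSys_Θ _ _ h _).symm.trans (congrArg _ (hβ.Θ_star _ _ h x)))

lemma starRepSysAux_toRepSys (n : ℕ) (f : S.Zc n) :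
    hβ.starRepSysAux (hβ.toRepSys n f) = hβ.toRepSys n (star f) :=
  hβ.starDirectSum_lof n f

/-- The involution of `S̈(α, β)`, determined by `(Θ̈_{∞,n} f)^* = Θ̈_{∞,n} (f^*)`. -/
def starRepSys : hβ.RepSys →ₗ⋆[ℂ] hβ.RepSys where
  toFun := hβ.starRepSysAux
  map_add' := map_add _
  map_smul' c x := by
    obtain ⟨n, f, rfl⟩ := hβ.exists_toRepSys x
    rw [← map_smul, starRepSysAux_toRepSys, starRepSysAux_toRepSys, star_smul, map_smul]
    rfl

lemma starRepSys_toRepSys (n : ℕ) (f : S.Zc n) :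
    hβ.starRepSys (hβ.toRepSys n f) = hβ.toRepSys n (star f) :=
  hβ.starRepSysAux_toRepSys n f

/-- The matrix order of `S̈(α, β)`: the positive cone of `M_k(S̈(α, β))` consists of the images of
the positive elements `Gᴴ G` of the `C*`-algebras `M_k(𝒵(A n))`. -/
def posRepSys (k : ℕ) : Set (Matrix (Fin k) (Fin k) hβ.RepSys) :=
  {X | ∃ (n : ℕ) (G : Matrix (Fin k) (Fin k) (S.Zc n)),
    X = (G.conjTranspose * G).map (hβ.toRepSys n)}

/-- States of `S̈(α, β)`: positive unital functionals. -/
def IsStateRepSys (φ : hβ.RepSys →ₗ[ℂ] ℂ) : Prop :=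
  φ hβ.unitRepSys = 1 ∧ ∀ X ∈ hβ.posRepSys 1, 0 ≤ φ (X 0 0)

/-! ### The representation operator system `S(α, β)` -/

/-- The kernel of the Archimedeanization: the common kernel of all states of `S̈(α, β)`. -/
def archKer : Submodule ℂ hβ.RepSys :=
  ⨅ (φ : hβ.RepSys →ₗ[ℂ] ℂ) (_ : hβ.IsStateRepSys φ), LinearMap.ker φ

/-- The vector space underlying the representation operator system `S(α, β)`, the
Archimedeanization of `S̈(α, β)`. -/
abbrev RepOpSys : Type (max u v) := hβ.RepSys ⧸ hβ.archKer

/-- The quotient map `q : S̈(α, β) → S(α, β)`. -/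
def q : hβ.RepSys →ₗ[ℂ] hβ.RepOpSys := hβ.archKer.mkQ

/-- The canonical maps `Θ_{∞,n} : 𝒵(A n) → S(α, β)`. -/
def toRepOpSys (n : ℕ) : S.Zc n →ₗ[ℂ] hβ.RepOpSys := hβ.q ∘ₗ hβ.toRepSys n

/-- The matrix order unit `e` of `S(α, β)`. -/
def unitRepOpSys : hβ.RepOpSys := hβ.q hβ.unitRepSys

lemma IsStateRepSys.nonneg {φ : hβ.RepSys →ₗ[ℂ] ℂ} (h : hβ.IsStateRepSys φ) (n : ℕ) (f : S.Zc n) :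
    0 ≤ φ (hβ.toRepSys n (star f * f)) := by
  have := h.2 _ ⟨n, Matrix.of fun _ _ => f, rfl⟩
  simpa [Matrix.mul_apply] using this

lemma IsStateRepSys.map_star {φ : hβ.RepSys →ₗ[ℂ] ℂ} (h : hβ.IsStateRepSys φ) (x : hβ.RepSys) :
    φ (hβ.starRepSys x) = star (φ x) := by
  obtain ⟨n, f, rfl⟩ := hβ.exists_toRepSys x
  rw [starRepSys_toRepSys]
  have h3 := (Complex.le_def.1 (IsStateRepSys.nonneg hβ h n 1)).2
  have h0 := (Complex.le_def.1 (IsStateRepSys.nonneg hβ h n f)).2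
  have h1 := (Complex.le_def.1 (IsStateRepSys.nonneg hβ h n (1 + f))).2
  have h2 := (Complex.le_def.1 (IsStateRepSys.nonneg hβ h n (1 + Complex.I • f))).2
  simp only [star_add, star_one, star_smul, add_mul, mul_add, one_mul, mul_one, smul_mul_assoc,
    mul_smul_comm, map_add, map_smul, smul_eq_mul, Complex.add_im, Complex.mul_im,
    Complex.star_def, Complex.conj_I, Complex.neg_re, Complex.neg_im, Complex.I_re, Complex.I_im,
    Complex.zero_im, Complex.mul_re] at h0 h1 h2 h3
  apply Complex.ext <;> simp only [Complex.star_def, Complex.conj_re, Complex.conj_im] <;> linarith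

lemma archKer_star : hβ.archKer ≤ hβ.archKer.comap hβ.starRepSys := by
  intro x hx
  simp only [archKer, Submodule.mem_iInf, LinearMap.mem_ker, Submodule.mem_comap] at hx ⊢
  intro φ hφ
  rw [IsStateRepSys.map_star hβ hφ, hx φ hφ, star_zero]

/-- The involution of `S(α, β)`, induced by that of `S̈(α, β)`. -/
def starRepOpSys : hβ.RepOpSys →ₗ⋆[ℂ] hβ.RepOpSys :=
  hβ.archKer.mapQ hβ.archKer hβ.starRepSys hβ.archKer_star

/-- The matrix order of `S(α, β)`: `q(Y)` is positive in `M_k(S(α, β))` if, for every `r > 0`,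
`Y + r ë` is positive in `M_k(S̈(α, β))` modulo the kernel of `q`. -/
def posRepOpSys (k : ℕ) : Set (Matrix (Fin k) (Fin k) hβ.RepOpSys) :=
  {X | ∀ r : ℝ, 0 < r → ∃ Y ∈ hβ.posRepSys k,
    X + Matrix.diagonal (fun _ => (r : ℂ) • hβ.unitRepOpSys) = Y.map hβ.q}

/-- The norm of the operator system `S(α, β)`:
`‖s‖ = inf {r > 0 : [[r e, s], [s^*, r e]] ≥ 0 in M_2(S(α, β))}`. -/
def normRepOpSys (s : hβ.RepOpSys) : ℝ :=
  sInf {r : ℝ | 0 < r ∧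
    !![(r : ℂ) • hβ.unitRepOpSys, s; hβ.starRepOpSys s, (r : ℂ) • hβ.unitRepOpSys] ∈
      hβ.posRepOpSys 2}

end Admissible

/-! ## Left multiplicative structures -/

/-- A left multiplicative structure: normal injective `*`-homomorphisms
`ι_{m,n} : A m ⊗̄ A n → A (m + n)` with the properties (m1), (m2), (m3) and (L).  In order to avoid
transports along equalities such as `(l + m) + n = l + (m + n)`, the target is written `A k` with a
proof of `m + n = k`.  Identities of normal maps on tensor products are stated on elementary
tensors. -/
structure LeftMult (S : FlowSequence.{u, v}) where
  ι : ∀ {m n k : ℕ}, m + n = k → (((S.A m).tensor (S.A n)).Op →⋆ₐ[ℂ] S.Alg k)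
  ι_injective : ∀ {m n k : ℕ} (h : m + n = k), Function.Injective (ι h)
  ι_normal : ∀ {m n k : ℕ} (h : m + n = k), AtomicAlg.IsNormalMap (ι h).toAlgHom.toLinearMap
  /-- (m1), left: `ι_{0,n}` is the natural map `ℂ ⊗ A n ≅ A n`. -/
  zero_left : ∀ {n : ℕ} (c : ℂ) (a : S.Alg n),
    ι (zero_add n) (AtomicAlg.tmul _ _ (algebraMap ℂ (S.Alg 0) c) a) = c • a
  /-- (m1), right: `ι_{m,0}` is the natural map `A m ⊗ ℂ ≅ A m`. -/
  zero_right : ∀ {m : ℕ} (a : S.Alg m) (c : ℂ),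
    ι (add_zero m) (AtomicAlg.tmul _ _ a (algebraMap ℂ (S.Alg 0) c)) = c • a
  /-- (m2): `ι_{l+m,n} ∘ (ι_{l,m} ⊗ id) = ι_{l,m+n} ∘ (id ⊗ ι_{m,n})`. -/
  assoc : ∀ {l m n lm mn k : ℕ} (h₁ : l + m = lm) (h₂ : lm + n = k) (h₃ : m + n = mn)
    (h₄ : l + mn = k) (a : S.Alg l) (b : S.Alg m) (c : S.Alg n),
    ι h₂ (AtomicAlg.tmul _ _ (ι h₁ (AtomicAlg.tmul _ _ a b)) c) =
      ι h₄ (AtomicAlg.tmul _ _ a (ι h₃ (AtomicAlg.tmul _ _ b c)))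
  /-- (m3): `ι_{m,n} ∘ (α_m^t ⊗ α_n^t) = α_{m+n}^t ∘ ι_{m,n}`. -/
  flow : ∀ {m n k : ℕ} (h : m + n = k) (t : ℝ) (a : S.Alg m) (b : S.Alg n),
    ι h (AtomicAlg.tmul _ _ (S.α m t a) (S.α n t b)) = S.α k t (ι h (AtomicAlg.tmul _ _ a b))
  /-- (L): the inclusion `A n → A (n + 1)` is `a ↦ ι_{n,1}(a ⊗ 1)`. -/
  incl_eq : ∀ (n : ℕ) (a : S.Alg n), S.incl n a = ι rfl (AtomicAlg.tmul _ _ a (1 : S.Alg 1))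

/-- A `*`-automorphism acts trivially on the center. -/
def FixesCenter {n : ℕ} (γ : S.Alg n ≃⋆ₐ[ℂ] S.Alg n) : Prop :=
  ∀ f : S.Zc n, γ ((S.A n).centerIncl f) = (S.A n).centerIncl f

namespace LeftMult

/-- Property (c) of a left multiplicative structure. -/
def PropertyC (L : S.LeftMult) : Prop :=
  ∀ {m n k : ℕ} (h : m + n = k) (h' : n + m = k),
    ∃ (γ : S.Alg k ≃⋆ₐ[ℂ] S.Alg k) (γ₁ : S.Alg m ≃⋆ₐ[ℂ] S.Alg m) (γ₂ : S.Alg n ≃⋆ₐ[ℂ] S.Alg n),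
      (FixesCenter γ ∧ FixesCenter γ₁ ∧ FixesCenter γ₂) ∧
      (∀ (a : S.Alg m) (b : S.Alg n), γ (L.ι h (AtomicAlg.tmul _ _ a b)) =
        L.ι h' (AtomicAlg.tmul _ _ (γ₂ b) (γ₁ a))) ∧
      ∀ (t : ℝ) (a : S.Alg k), γ (S.α k t a) = S.α k t (γ a)

variable (L : S.LeftMult) (hβ : S.Admissible β)

/-- The bilinear map `𝒵(A m) × 𝒵(A n) → 𝒵(A (m + n))`, `(f, g) ↦ E_{m+n}(ι_{m,n}(f ⊗ g))`. -/
def prod (m n : ℕ) : S.Zc m →ₗ[ℂ] S.Zc n →ₗ[ℂ] S.Zc (m + n) :=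
  ((AtomicAlg.tmul (S.A m) (S.A n)).compl₁₂ (S.A m).centerIncl.toAlgHom.toLinearMap
    (S.A n).centerIncl.toAlgHom.toLinearMap).compr₂
    (hβ.E (m + n) ∘ₗ (L.ι (rfl : m + n = m + n)).toAlgHom.toLinearMap)

lemma prod_apply (m n : ℕ) (f : S.Zc m) (g : S.Zc n) :
    L.prod hβ m n f g = hβ.E (m + n) (L.ι rfl
      (AtomicAlg.tmul _ _ ((S.A m).centerIncl f) ((S.A n).centerIncl g))) := rfl

end LeftMult

/-- The algebraic direct sum `Σ(α, β) = ⨁ₙ 𝒵(A n)`. -/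
abbrev DSum (S : FlowSequence.{u, v}) : Type (max u v) := ⨁ n, S.Zc n

/-- The inclusion `𝒵(A n) → Σ(α, β)`. -/
def toDSum (S : FlowSequence.{u, v}) (n : ℕ) : S.Zc n →ₗ[ℂ] S.DSum :=
  DirectSum.lof ℂ ℕ S.Zc n

/-- The element `1_n ∈ Σ(α, β)`, the unit of `𝒵(A n)`. -/
def oneDSum (S : FlowSequence.{u, v}) (n : ℕ) : S.DSum := S.toDSum n 1

namespace LeftMult

variable (L : S.LeftMult) (hβ : S.Admissible β)

/-- The multiplication of `Σ(α, β)`: the bilinear map that is given by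
`f · g = E_{m+n}(ι_{m,n}(f ⊗ g))` for `f ∈ 𝒵(A m)` and `g ∈ 𝒵(A n)`. -/
def mulDSum : S.DSum →ₗ[ℂ] S.DSum →ₗ[ℂ] S.DSum :=
  DirectSum.toModule ℂ ℕ (S.DSum →ₗ[ℂ] S.DSum) fun m =>
    (DirectSum.toModule ℂ ℕ (S.Zc m →ₗ[ℂ] S.DSum) fun n =>
      ((L.prod hβ m n).compr₂ (S.toDSum (m + n))).flip).flip

lemma mulDSum_apply (m n : ℕ) (f : S.Zc m) (g : S.Zc n) :
    L.mulDSum hβ (S.toDSum m f) (S.toDSum n g) = S.toDSum (m + n) (L.prod hβ m n f g) := by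
  simp [mulDSum, toDSum]

/-- The left action of `Σ(α, β)` on `V = S̈(α, β)` or `V = S(α, β)` (with the canonical maps `T n`
from `𝒵(A n)` to `V`): it is given by `f · T_n(g) = T_{m+n}(E_{m+n}(ι_{m,n}(f ⊗ g)))`, and it is
a left module structure. -/
structure IsLeftAction {V : Type*} [AddCommMonoid V] [Module ℂ V] (T : ∀ n, S.Zc n →ₗ[ℂ] V)
    (act : S.DSum →ₗ[ℂ] V →ₗ[ℂ] V) : Prop where
  formula : ∀ m n (f : S.Zc m) (g : S.Zc n),
    act (S.toDSum m f) (T n g) = T (m + n) (L.prod hβ m n f g)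
  one_act : ∀ s, act (S.oneDSum 0) s = s
  mul_act : ∀ x y s, act (L.mulDSum hβ x y) s = act x (act y s)

end LeftMult

end FlowSequence

/-! ## Algebras -/

section Algebras

variable {V W : Type*} [AddCommMonoid V] [Module ℂ V] [AddCommMonoid W] [Module ℂ W]

/-- The bilinear map `mul` makes `V` a unital commutative (associative) complex algebra with
unit `one`. -/
structure IsUnitalCommAlgebra (mul : V →ₗ[ℂ] V →ₗ[ℂ] V) (one : V) : Prop where
  mul_assoc : ∀ x y z, mul (mul x y) z = mul x (mul y z)
  mul_comm : ∀ x y, mul x y = mul y x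
  one_mul : ∀ x, mul one x = x

/-- The linear map `φ : V → W` is a surjective homomorphism of unital algebras. -/
structure IsSurjAlgHom (mulV : V →ₗ[ℂ] V →ₗ[ℂ] V) (oneV : V) (mulW : W →ₗ[ℂ] W →ₗ[ℂ] W)
    (oneW : W) (φ : V →ₗ[ℂ] W) : Prop where
  map_mul : ∀ x y, φ (mulV x y) = mulW (φ x) (φ y)
  map_one : φ oneV = oneW
  surjective : Function.Surjective φ

/-- The function `N` is a norm on `V` that makes the algebra `V` a normed algebra with
normalized unit. -/
structure IsAlgebraNorm (mul : V →ₗ[ℂ] V →ₗ[ℂ] V) (one : V) (N : V → ℝ) : Prop where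
  nonneg : ∀ x, 0 ≤ N x
  eq_zero_iff : ∀ x, N x = 0 ↔ x = 0
  add_le : ∀ x y, N (x + y) ≤ N x + N y
  smul : ∀ (c : ℂ) x, N (c • x) = ‖c‖ * N x
  mul_le : ∀ x y, N (mul x y) ≤ N x * N y
  norm_one : N one = 1

end Algebras

end RepSystem

end

open RepSystem

noncomputable section

namespace RepSystem

/-! ## Normal functionals -/

/-! Everything rests on the uniqueness of the KMS states. Let `j : A m → A n` be a normal
equivariant `*`-homomorphism and `d` an element that commutes with its range. For each block `w` the
functional `a ↦ τ_w(j(a) d^* d)` is normal, and its restrictions to the blocks of `A m` are positive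
and KMS, hence multiples of the `τ_z`. Normality and polarization then give `E(j(a) c) = E(j(E(a))
c)` for every `c` that commutes with the range (`E_comp_mul`). For `j = ι(· ⊗ 1)` and `c = ι(1 ⊗
b)`, this says that `E(ι(a ⊗ b))` depends on `a` only through `E(a)` (`E_tm_left`). Uniqueness also
makes `E` invariant under automorphisms that fix the center and commute with the flow
(`E_fixesCenter`), so property (c) exchanges the tensor factors and yields the same statement for
`b` (`PropertyC.E_tm_right`).

Inner expectations can therefore be dropped from triple products, and associativity reduces to (m2).
Commutativity is the exchange itself, because the twisting automorphisms do nothing to central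
elements. By (L), `Θ_{n+1,n}` is multiplication by the unit of `𝒵(A 1)`; hence the product is
compatible with the transition maps in both variables and descends to `S̈`. The actions of `Σ` are
pulled back along the canonical surjection.

The order enters through a Schur product theorem (`isPos_schur`): the values of `E ∘ ι` are states,
and a state turns the entrywise product of `G^* G` and `H^* H` into a sum of Gram matrices. So
multiplication by a positive element carries a state to a positive functional, the common kernel of
the states is an ideal, and the product descends to `S`. The Schur product of two matrices `[[r e,
s], [s^*, r e]]` is a matrix of the same shape for the products of the `r` and of the `s`
(`normMatrix_schur`), whence `‖st‖ ≤ ‖s‖ ‖t‖`. States bound the norm from below (`norm_state_le`),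
which gives definiteness and, since a state exists, `‖e‖ = 1`. -/

lemma hasSum_of_eq {ι : Type*} {f g : ι → ℂ} {s : ℂ} (h : ∀ i, f i = g i) (hg : HasSum g s) :
    HasSum f s :=
  funext h ▸ hg

/-- A family over an arbitrary index type that is summable with respect to a weight `N` can be
re-indexed by `ℕ`, with the same sums of all functions that vanish where `N` does. -/
lemma exists_nat_family {ι X : Type*} (x₀ : X) (N : X → ℝ) (h₀ : N x₀ = 0) (p : ι → X)
    (hp : Summable fun i => N (p i)) :
    ∃ q : ℕ → X, Summable (fun n => N (q n)) ∧
      ∀ t : X → ℂ, (∀ x, N x = 0 → t x = 0) → ∀ s, HasSum (fun i => t (p i)) s →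
        HasSum (fun n => t (q n)) s := by
  classical
  -- Only countably many indices carry weight. They are injected into `ℕ`, and the unused places are
  -- filled with the weightless point `x₀`.
  let J := Function.support fun i => N (p i)
  have : Countable J := hp.countable_support.to_subtype
  obtain ⟨e, he⟩ := exists_injective_nat J
  let q : ℕ → X := Function.extend e (fun j => p j) fun _ => x₀
  have hq : ∀ j : J, q (e j) = p j := fun j => he.extend_apply _ _ _
  have hq' : ∀ n ∉ Set.range e, q n = x₀ := fun n hn =>
    Function.extend_apply' _ _ _ (by simpa using hn)
  refine ⟨q, ?_, fun t ht s hs => ?_⟩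
  · rw [← he.summable_iff fun n hn => by rw [hq' n hn, h₀]]
    exact (summable_congr fun j => by rw [Function.comp_apply, hq, Function.comp_apply]).2
      (hp.subtype J)
  · rw [← he.hasSum_iff fun n hn => by rw [hq' n hn, ht _ h₀]]
    rw [← hasSum_subtype_iff_of_support_subset (s := J) fun i hi h => hi (ht _ h)] at hs
    exact hasSum_of_eq (fun j => by rw [Function.comp_apply, Function.comp_apply, hq]) hs

section

variable {E : Type v} [NormedAddCommGroup E] [InnerProductSpace ℂ E]

lemma inner_eq_zero_of_norm_mul {ξ η : E} (x : E →L[ℂ] E) (h : ‖ξ‖ * ‖η‖ = 0) :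
    inner ℂ ξ (x η) = 0 := by
  rcases mul_eq_zero.1 h with h | h <;> rw [norm_eq_zero.1 h] <;> simp

/-- Sums indexed by disjoint unions, by subtypes or by Hilbert bases are thereby admitted as
witnesses of normality. -/
lemma isNormal_of_hasSum {ι : Type*} (τ : (E →L[ℂ] E) →ₗ[ℂ] ℂ) (ξ η : ι → E)
    (hs : Summable fun i => ‖ξ i‖ * ‖η i‖)
    (h : ∀ x : E →L[ℂ] E, HasSum (fun i => inner ℂ (ξ i) (x (η i))) (τ x)) : IsNormal τ := by
  obtain ⟨q, hq, hq'⟩ := exists_nat_family (0 : E × E) (fun p => ‖p.1‖ * ‖p.2‖) (by simp)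
    (fun i => (ξ i, η i)) hs
  exact ⟨fun n => (q n).1, fun n => (q n).2, hq, fun x =>
    hq' (fun p => inner ℂ p.1 (x p.2)) (fun p => inner_eq_zero_of_norm_mul x) _ (h x)⟩

lemma IsNormal.add {τ σ : (E →L[ℂ] E) →ₗ[ℂ] ℂ} (hτ : IsNormal τ) (hσ : IsNormal σ) :
    IsNormal (τ + σ) := by
  obtain ⟨ξ, η, h, h'⟩ := hτ
  obtain ⟨ξ', η', k, k'⟩ := hσ
  exact isNormal_of_hasSum _ (Sum.elim ξ ξ') (Sum.elim η η')
    (Summable.sum (f := fun i => ‖(Sum.elim ξ ξ' i)‖ * ‖(Sum.elim η η' i)‖) h k) fun x =>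
      HasSum.sum (f := fun i => inner ℂ (Sum.elim ξ ξ' i) (x (Sum.elim η η' i))) (h' x) (k' x)

lemma IsNormal.smul {τ : (E →L[ℂ] E) →ₗ[ℂ] ℂ} (hτ : IsNormal τ) (c : ℂ) :
    IsNormal (c • τ) := by
  obtain ⟨ξ, η, h, h'⟩ := hτ
  refine ⟨ξ, fun n => c • η n, ?_, fun x => ?_⟩
  · exact (summable_congr fun n => by rw [norm_smul]; ring).2 (h.mul_left ‖c‖)
  · simpa [inner_smul_right] using (h' x).mul_left c

end

namespace AtomicAlg

variable {A : AtomicAlg.{u, v}}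

/-- Some block must exist, since the padding of the series by zero vectors has to take place in one.
-/
lemma isNormalFunctional_of_hasSum [Nonempty A.Z] {ι : Type*} (φ : A.Op →ₗ[ℂ] ℂ) (z : ι → A.Z)
    (ξ η : ∀ i, A.H (z i)) (hs : Summable fun i => ‖ξ i‖ * ‖η i‖)
    (h : ∀ a : A.Op, HasSum (fun i => inner ℂ (ξ i) (comp (z i) a (η i))) (φ a)) :
    A.IsNormalFunctional φ := by
  obtain ⟨q, hq, hq'⟩ := exists_nat_family (X := Σ z : A.Z, A.H z × A.H z)
    ⟨Classical.arbitrary _, 0, 0⟩ (fun p => ‖p.2.1‖ * ‖p.2.2‖) (by simp)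
    (fun i => ⟨z i, ξ i, η i⟩) hs
  exact ⟨fun n => (q n).1, fun n => (q n).2.1, fun n => (q n).2.2, hq, fun a =>
    hq' (fun p => inner ℂ p.2.1 (comp p.1 a p.2.2)) (fun p => inner_eq_zero_of_norm_mul _) _ (h a)⟩

lemma comp_block_self (z : A.Z) (x : A.H z →L[ℂ] A.H z) : comp z (block z x) = x := by
  simp [block, comp_ofFamily]

lemma comp_block_ne {z w : A.Z} (h : w ≠ z) (x : A.H z →L[ℂ] A.H z) :
    comp w (block z x) = 0 := by
  simp [block, comp_ofFamily, h]

lemma block_add (z : A.Z) (x y : A.H z →L[ℂ] A.H z) : block z (x + y) = block z x + block z y :=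
  op_ext fun w => by
    by_cases h : w = z
    · subst h; simp [comp_add, comp_block_self]
    · simp [comp_add, comp_block_ne h]

lemma block_smul (z : A.Z) (c : ℂ) (x : A.H z →L[ℂ] A.H z) : block z (c • x) = c • block z x :=
  op_ext fun w => by
    by_cases h : w = z
    · subst h; simp [comp_smul, comp_block_self]
    · simp [comp_smul, comp_block_ne h]

lemma block_mul (z : A.Z) (x y : A.H z →L[ℂ] A.H z) : block z (x * y) = block z x * block z y :=
  op_ext fun w => by
    by_cases h : w = z
    · subst h; simp [comp_mul, comp_block_self]
    · simp [comp_mul, comp_block_ne h]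

lemma block_star (z : A.Z) (x : A.H z →L[ℂ] A.H z) : block z (star x) = star (block z x) :=
  op_ext fun w => by
    by_cases h : w = z
    · subst h; simp [comp_star, comp_block_self]
    · simp [comp_star, comp_block_ne h]

lemma block_comp (z : A.Z) (a : A.Op) : block z (comp z a) = a * block z 1 :=
  op_ext fun w => by
    by_cases h : w = z
    · subst h; simp [comp_mul, comp_block_self]
    · simp [comp_mul, comp_block_ne h]

lemma block_one_mul (z : A.Z) (a : A.Op) : block z 1 * a = a * block z 1 :=
  op_ext fun w => by
    by_cases h : w = z
    · subst h; simp [comp_mul, comp_block_self]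
    · simp [comp_mul, comp_block_ne h]

/-- The map `block z` as a linear map. -/
def blockₗ (z : A.Z) : (A.H z →L[ℂ] A.H z) →ₗ[ℂ] A.Op where
  toFun := block z
  map_add' := block_add z
  map_smul' := block_smul z

/-- The map `comp z` as a linear map. -/
def compₗ (z : A.Z) : A.Op →ₗ[ℂ] (A.H z →L[ℂ] A.H z) where
  toFun := comp z
  map_add' := comp_add z
  map_smul' := comp_smul z

/-- The restriction of a normal functional to a block is normal. -/
lemma IsNormalFunctional.comp_block {φ : A.Op →ₗ[ℂ] ℂ} (hφ : A.IsNormalFunctional φ) (z : A.Z) :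
    IsNormal (φ ∘ₗ blockₗ z) := by
  obtain ⟨w, ξ, η, hs, h⟩ := hφ
  refine isNormal_of_hasSum (ι := {k // w k = z}) _ (fun k => k.2 ▸ ξ k) (fun k => k.2 ▸ η k) ?_
    fun x => ?_
  · refine (summable_congr ?_).2 (hs.subtype {k | w k = z})
    rintro ⟨k, rfl⟩
    rfl
  · have h1 := h (block z x)
    rw [← hasSum_subtype_iff_of_support_subset (s := {k | w k = z})] at h1
    · refine hasSum_of_eq ?_ h1
      rintro ⟨k, rfl⟩
      simp [comp_block_self]
    · intro k hk
      by_contra hne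
      exact hk (by simp [comp_block_ne hne])

/-- Normal states of a block define normal functionals. -/
lemma isNormalFunctional_comp [Nonempty A.Z] {z : A.Z} {τ : (A.H z →L[ℂ] A.H z) →ₗ[ℂ] ℂ}
    (hτ : IsNormal τ) : A.IsNormalFunctional (τ ∘ₗ compₗ z) := by
  obtain ⟨ξ, η, hs, h⟩ := hτ
  exact ⟨fun _ => z, ξ, η, hs, fun a => h (comp z a)⟩

/-- The factor `c` is absorbed into the vectors `η k`, whose norms grow at most by the factor `‖c‖`.
-/
lemma IsNormalFunctional.mul_right {φ : A.Op →ₗ[ℂ] ℂ} (hφ : A.IsNormalFunctional φ) (c : A.Op) :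
    A.IsNormalFunctional (φ ∘ₗ LinearMap.mulRight ℂ c) := by
  obtain ⟨z, ξ, η, hs, h⟩ := hφ
  refine ⟨z, ξ, fun k => comp (z k) c (η k), ?_, fun a => h (a * c)⟩
  refine Summable.of_nonneg_of_le (fun _ => by positivity) (fun k => ?_) (hs.mul_left ‖c‖)
  have : ‖comp (z k) c (η k)‖ ≤ ‖c‖ * ‖η k‖ :=
    (ContinuousLinearMap.le_opNorm _ _).trans
      (mul_le_mul_of_nonneg_right (norm_comp_le _ _) (norm_nonneg _))
  calc ‖ξ k‖ * ‖comp (z k) c (η k)‖ ≤ ‖ξ k‖ * (‖c‖ * ‖η k‖) := by gcongr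
    _ = _ := by ring

/-- A normal functional that vanishes on all blocks of an element vanishes on the element. -/
lemma IsNormalFunctional.eq_zero_of_block {φ : A.Op →ₗ[ℂ] ℂ} (hφ : A.IsNormalFunctional φ)
    (a : A.Op) (ha : ∀ z, φ (block z (comp z a)) = 0) : φ a = 0 := by
  obtain ⟨w, ξ, η, hs, h⟩ := hφ
  -- The series is regrouped along the fibers of `w`; the partial sum over the fiber of `z` is the
  -- value of `φ` at the block `z` of `a`.
  have h1 := (Equiv.sigmaFiberEquiv w).hasSum_iff.2 (h a)
  refine (h1.sigma (g := fun _ => 0) fun z => ?_).unique hasSum_zero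
  have h2 := h (block z (comp z a))
  rw [ha, ← hasSum_subtype_iff_of_support_subset (s := {k | w k = z})] at h2
  · refine hasSum_of_eq ?_ h2
    rintro ⟨k, rfl⟩
    simp [comp_block_self]
    rfl
  · intro k hk
    by_contra hne
    exact hk (by simp [comp_block_ne hne])

/-! ## Tensor products -/

section OpTensor

variable {E K : Type v} [NormedAddCommGroup E] [InnerProductSpace ℂ E]
    [NormedAddCommGroup K] [InnerProductSpace ℂ K]

open UniformSpace

lemma opTensor_mul (x x' : E →L[ℂ] E) (y y' : K →L[ℂ] K) :
    opTensor (x * x') (y * y') = opTensor x y * opTensor x' y' :=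
  opTensor_ext fun e k => by simp [opTensor_tmul]

lemma opTensor_one : opTensor (1 : E →L[ℂ] E) (1 : K →L[ℂ] K) = 1 :=
  opTensor_ext fun e k => by simp [opTensor_tmul]

/-- Vectors of the Hilbert space tensor product with the same inner products with all elementary
tensors agree. -/
lemma completion_tensor_ext_inner {v w : Completion (E ⊗[ℂ] K)}
    (h : ∀ (e : E) (k : K), inner ℂ ((e ⊗ₜ[ℂ] k : E ⊗[ℂ] K) : Completion (E ⊗[ℂ] K)) v =
      inner ℂ ((e ⊗ₜ[ℂ] k : E ⊗[ℂ] K) : Completion (E ⊗[ℂ] K)) w) : v = w := by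
  refine ext_inner_left ℂ fun u => ?_
  induction u using Completion.induction_on with
  | hp => exact isClosed_eq (by fun_prop) (by fun_prop)
  | ih u =>
    induction u using TensorProduct.induction_on with
    | zero => rw [Completion.coe_zero, inner_zero_left, inner_zero_left]
    | tmul e k => exact h e k
    | add a b ha hb => simp only [Completion.coe_add, inner_add_left, ha, hb]

lemma opTensor_star [CompleteSpace E] [CompleteSpace K] (x : E →L[ℂ] E) (y : K →L[ℂ] K) :
    opTensor (star x) (star y) = star (opTensor x y) :=
  opTensor_ext fun e k => completion_tensor_ext_inner fun e' k' => by
    rw [opTensor_tmul, ContinuousLinearMap.star_eq_adjoint (opTensor x y),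
      ContinuousLinearMap.adjoint_inner_right, opTensor_tmul]
    simp [ContinuousLinearMap.star_eq_adjoint, ContinuousLinearMap.adjoint_inner_right]

/-- The norm of the tensor product is a cross norm, so `v ⊗ k = 0` with `k ≠ 0` forces `v = 0`. -/
lemma opTensor_one_right_injective [Nontrivial K] {x x' : E →L[ℂ] E}
    (h : opTensor x (1 : K →L[ℂ] K) = opTensor x' 1) : x = x' := by
  obtain ⟨k, hk⟩ := exists_ne (0 : K)
  ext e
  have h1 : ((x e ⊗ₜ[ℂ] k : E ⊗[ℂ] K) : Completion (E ⊗[ℂ] K)) = (x' e ⊗ₜ[ℂ] k : E ⊗[ℂ] K) := by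
    have := congrArg (fun T => T ((e ⊗ₜ[ℂ] k : E ⊗[ℂ] K) : Completion (E ⊗[ℂ] K))) h
    simpa [opTensor_tmul] using this
  have h2 : ‖((x e - x' e) ⊗ₜ[ℂ] k : E ⊗[ℂ] K)‖ = 0 := by
    rw [TensorProduct.sub_tmul, ← Completion.norm_coe, Completion.coe_sub, h1, sub_self, norm_zero]
  rw [TensorProduct.norm_tmul, mul_eq_zero, norm_eq_zero, norm_eq_zero] at h2
  exact sub_eq_zero.1 (h2.resolve_right hk)

/-- The isometry `e ↦ e ⊗ k` for a unit vector `k`. -/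
def tmulIsometry (E : Type v) [NormedAddCommGroup E] [InnerProductSpace ℂ E] {k : K}
    (hk : ‖k‖ = 1) : E →ₗᵢ[ℂ] Completion (E ⊗[ℂ] K) where
  toFun e := ((e ⊗ₜ[ℂ] k : E ⊗[ℂ] K) : Completion (E ⊗[ℂ] K))
  map_add' a b := by rw [TensorProduct.add_tmul, Completion.coe_add]
  map_smul' c a := by simp [← TensorProduct.smul_tmul', Completion.coe_smul]
  norm_map' a := by
    change ‖((a ⊗ₜ[ℂ] k : E ⊗[ℂ] K) : Completion (E ⊗[ℂ] K))‖ = _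
    rw [Completion.norm_coe, TensorProduct.norm_tmul, hk, mul_one]

lemma tmulIsometry_apply {k : K} (hk : ‖k‖ = 1) (e : E) :
    tmulIsometry E hk e = ((e ⊗ₜ[ℂ] k : E ⊗[ℂ] K) : Completion (E ⊗[ℂ] K)) := rfl

/-- The Hilbert space tensor product `E ⊗ K` is the Hilbert sum of the `E ⊗ k i` for a Hilbert
basis `k` of `K`. -/
lemma isHilbertSum_tmulIsometry [CompleteSpace E] {ι : Type*}
    (b : HilbertBasis ι ℂ K) :
    IsHilbertSum ℂ (fun _ : ι => E) fun i => tmulIsometry E (b.orthonormal.1 i) := by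
  refine IsHilbertSum.mk (fun i j hij e e' => ?_) ?_
  · simp [tmulIsometry_apply, b.orthonormal.2 hij]
  · set M := (⨆ i, LinearMap.range (tmulIsometry E (b.orthonormal.1 i)).toLinearMap)
    rw [top_le_iff, Submodule.eq_top_iff']
    intro w
    have key : ∀ (e : E) (k : K),
        ((e ⊗ₜ[ℂ] k : E ⊗[ℂ] K) : Completion (E ⊗[ℂ] K)) ∈ M.topologicalClosure := by
      intro e k
      -- Continuity of `k ↦ e ⊗ k` transports the density of the span of the basis.
      let T : K →L[ℂ] Completion (E ⊗[ℂ] K) :=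
        (Completion.toComplL : (E ⊗[ℂ] K) →L[ℂ] _) ∘L TensorProduct.mkL ℂ E K e
      have h1 : Submodule.span ℂ (Set.range b) ≤ M.comap T.toLinearMap := by
        rw [Submodule.span_le]
        rintro _ ⟨i, rfl⟩
        exact Submodule.mem_iSup_of_mem i ⟨e, rfl⟩
      have h2 : k ∈ closure (Submodule.span ℂ (Set.range b) : Set K) := by
        have := b.dense_span
        rw [← Submodule.topologicalClosure_coe, this]; trivial
      exact map_mem_closure (f := T) T.continuous h2 fun x hx => h1 hx
    induction w using Completion.induction_on with
    | hp => exact M.isClosed_topologicalClosure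
    | ih w =>
      induction w using TensorProduct.induction_on with
      | zero => rw [Completion.coe_zero]; exact zero_mem _
      | tmul e k => exact key e k
      | add a b ha hb =>
        rw [Completion.coe_add]
        exact add_mem ha hb

/-- The coordinates of `(x ⊗ 1) η` in the Hilbert sum are the images under `x` of those of `η`. -/
lemma exists_hasSum_inner_opTensor_one [CompleteSpace E] [CompleteSpace K]
    (ξ η : Completion (E ⊗[ℂ] K)) :
    ∃ (ι : Type v) (ξ' η' : ι → E), Summable (fun i => ‖ξ' i‖ * ‖η' i‖) ∧
      (∑' i, ‖ξ' i‖ * ‖η' i‖ ≤ ‖ξ‖ * ‖η‖) ∧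
      ∀ x : E →L[ℂ] E, HasSum (fun i => inner ℂ (ξ' i) (x (η' i)))
        (inner ℂ ξ (opTensor x (1 : K →L[ℂ] K) η)) := by
  obtain ⟨w, b, -⟩ := exists_hilbertBasis ℂ K
  have hV := isHilbertSum_tmulIsometry (E := E) b
  set U := hV.linearIsometryEquiv
  have h2 : Real.HolderConjugate 2 2 := by norm_num [Real.holderConjugate_iff]
  have hsq : ∀ v : Completion (E ⊗[ℂ] K), HasSum (fun i => ‖U v i‖ ^ (2 : ℝ)) (‖v‖ ^ (2 : ℝ)) := by
    intro v
    have := lp.hasSum_norm (p := 2) (by norm_num) (U v)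
    simpa using this
  -- Cauchy–Schwarz for the sequences of coordinate norms. The bound on the sum is what later makes
  -- the double series over all pairs `(ξ k, η k)` converge.
  have hH := Real.summable_and_inner_le_Lp_mul_Lq_tsum_of_nonneg h2 (fun i => norm_nonneg (U ξ i))
    (fun i => norm_nonneg (U η i)) (hsq ξ).summable (hsq η).summable
  refine ⟨w, fun i => U ξ i, fun i => U η i, hH.1, ?_, fun x => ?_⟩
  · refine hH.2.trans_eq ?_
    rw [(hsq ξ).tsum_eq, (hsq η).tsum_eq, ← Real.rpow_mul (norm_nonneg _),
      ← Real.rpow_mul (norm_nonneg _)]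
    norm_num
  · have hη := hV.hasSum_linearIsometryEquiv_symm (U η)
    rw [LinearIsometryEquiv.symm_apply_apply] at hη
    have h3 := (hη.mapL (opTensor x (1 : K →L[ℂ] K))).mapL (innerSL ℂ ξ)
    refine hasSum_of_eq (fun i => ?_) h3
    have h4 : opTensor x (1 : K →L[ℂ] K) (tmulIsometry E (b.orthonormal.1 i) (U η i)) =
        tmulIsometry E (b.orthonormal.1 i) (x (U η i)) := by
      rw [tmulIsometry_apply, opTensor_tmul, tmulIsometry_apply, one_apply_eq_self]
    rw [h4, innerSL_apply_apply]
    classical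
    rw [← LinearIsometryEquiv.inner_map_map U ξ, ← hV.linearIsometryEquiv_symm_apply_single,
      LinearIsometryEquiv.apply_symm_apply, lp.inner_single_right]

end OpTensor

variable {B : AtomicAlg.{u, v}}

lemma comp_tmul (p : (A.tensor B).Z) (a : A.Op) (b : B.Op) :
    comp p (tmul A B a b) = opTensor (comp p.1 a) (comp p.2 b) := rfl

lemma tmul_mul (a a' : A.Op) (b b' : B.Op) :
    tmul A B (a * a') (b * b') = tmul A B a b * tmul A B a' b' :=
  op_ext fun p => by simp only [comp_mul, comp_tmul, opTensor_mul]

lemma tmul_star (a : A.Op) (b : B.Op) : tmul A B (star a) (star b) = star (tmul A B a b) :=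
  op_ext fun p => by simp only [comp_star, comp_tmul, opTensor_star]

lemma tmul_one : tmul A B 1 1 = 1 :=
  op_ext fun p => by simp only [comp_one, comp_tmul, opTensor_one]

lemma tmul_one_injective [Nonempty B.Z] {a a' : A.Op} (h : tmul A B a 1 = tmul A B a' 1) :
    a = a' :=
  op_ext fun z => opTensor_one_right_injective <|
    congrArg (comp (A := A.tensor B) (z, Classical.arbitrary B.Z)) h

/-- The map `a ↦ a ⊗ 1` is normal. -/
lemma isNormalMap_tmul_one [Nonempty A.Z] : IsNormalMap ((tmul A B).flip 1) := by
  rintro φ ⟨z, ξ, η, hs, h⟩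
  choose ι ξ' η' hs' hle hsum using fun k => exists_hasSum_inner_opTensor_one (ξ k) (η k)
  have hS : Summable fun i : Σ k, ι k => ‖ξ' i.1 i.2‖ * ‖η' i.1 i.2‖ := by
    rw [summable_sigma_of_nonneg fun _ => by positivity]
    exact ⟨hs', Summable.of_nonneg_of_le (fun k => tsum_nonneg fun _ => by positivity) hle hs⟩
  refine isNormalFunctional_of_hasSum (ι := Σ k, ι k) _ (fun i => (z i.1).1)
    (fun i => ξ' i.1 i.2) (fun i => η' i.1 i.2) hS fun a => ?_
  have hsm : Summable fun i : Σ k, ι k => inner ℂ (ξ' i.1 i.2) (comp (z i.1).1 a (η' i.1 i.2)) := by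
    refine Summable.of_norm_bounded (hS.mul_left ‖a‖) fun i => ?_
    have : ‖comp (z i.1).1 a (η' i.1 i.2)‖ ≤ ‖a‖ * ‖η' i.1 i.2‖ :=
      (ContinuousLinearMap.le_opNorm _ _).trans
        (mul_le_mul_of_nonneg_right (norm_comp_le _ _) (norm_nonneg _))
    calc _ ≤ ‖ξ' i.1 i.2‖ * ‖comp (z i.1).1 a (η' i.1 i.2)‖ := norm_inner_le_norm _ _
      _ ≤ ‖ξ' i.1 i.2‖ * (‖a‖ * ‖η' i.1 i.2‖) := by gcongr
      _ = _ := by ring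
  have h1 := hsm.hasSum.sigma (fun k => hsum k (comp (z k).1 a))
  have h2 := h (tmul A B a 1)
  rw [show (φ ∘ₗ (tmul A B).flip 1) a = φ (tmul A B a 1) from rfl, ← h1.unique h2]
  exact hsm.hasSum

end AtomicAlg

/-- Polarization against the unit: `c` is a combination of elements `d^* d` with `d = 1 + s c`, and
such a `d` commutes with everything that `c` commutes with. For central `c` the `d` are central as
well. -/
lemma polarization_one {R : Type*} [Ring R] [StarRing R] [Algebra ℂ R] [StarModule ℂ R] (c : R) :
    c = (4 : ℂ)⁻¹ • ((star (1 + (1 : ℂ) • c) * (1 + (1 : ℂ) • c)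
      - star (1 + (-1 : ℂ) • c) * (1 + (-1 : ℂ) • c))
      - Complex.I • (star (1 + Complex.I • c) * (1 + Complex.I • c)
      - star (1 + (-Complex.I) • c) * (1 + (-Complex.I) • c))) := by
  simp only [star_add, star_one, star_smul, add_mul, mul_add, one_mul, mul_one, smul_mul_assoc,
    mul_smul_comm, smul_smul, smul_sub, smul_add, star_neg, Complex.star_def, Complex.conj_I]
  match_scalars <;> ring_nf <;> simp
  norm_num

namespace AtomicAlg

variable {A : AtomicAlg.{u, v}}

/-- The components of a central element are scalars. -/
lemma exists_comp_eq_smul {c : A.Op} (hc : ∀ a, c * a = a * c) (z : A.Z) :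
    ∃ r : ℂ, comp z c = r • 1 := by
  have h : comp z c ∈ Subalgebra.center ℂ (A.H z →L[ℂ] A.H z) := by
    rw [Subalgebra.mem_center_iff]
    intro x
    have := congrArg (comp z) (hc (block z x))
    rw [comp_mul, comp_mul, comp_block_self] at this
    exact this.symm
  obtain ⟨r, hr⟩ := Algebra.mem_bot.1 (Algebra.IsCentral.out h)
  exact ⟨r, by rw [← hr, Algebra.algebraMap_eq_smul_one]⟩

lemma centerIncl_comm (f : A.Center) (a : A.Op) :
    A.centerIncl f * a = a * A.centerIncl f :=
  (Subalgebra.mem_center_iff.1 f.2 a).symm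

end AtomicAlg

/-! ### The flow acts block by block -/

namespace FlowSequence

open AtomicAlg

variable {S : FlowSequence.{u, v}}

lemma nontrivial_alg (S : FlowSequence.{u, v}) (n : ℕ) : Nontrivial (S.Alg n) := by
  induction n with
  | zero => exact S.zero_eq_complex.1.nontrivial
  | succ n ih => exact (S.incl_injective n).nontrivial

instance (n : ℕ) : Nonempty (S.A n).Z := by
  by_contra h
  have := not_nonempty_iff.1 h
  obtain ⟨a, b, hab⟩ := S.nontrivial_alg n
  exact hab (op_ext fun z => this.elim z)

lemma α_symm (n : ℕ) (t : ℝ) (a : S.Alg n) : S.α n (-t) (S.α n t a) = a := by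
  rw [← S.α_add, neg_add_cancel, S.α_zero]

/-- Minimal central projections are fixed by the flow for small times. -/
lemma eventually_comp_α_block_one (n : ℕ) (z : (S.A n).Z) :
    ∀ᶠ t in nhds (0 : ℝ), comp z (S.α n t (block z 1)) = 1 := by
  obtain ⟨ξ, hξ⟩ := exists_ne (0 : (S.A n).H z)
  let ψ : ((S.A n).H z →L[ℂ] (S.A n).H z) →ₗ[ℂ] ℂ :=
    { toFun := fun x => inner ℂ ξ (x ξ)
      map_add' := fun x y => by rw [add_apply, inner_add_right]
      map_smul' := fun c x => by simp }
  have hψ : IsNormal ψ := by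
    refine isNormal_of_hasSum (ι := Unit) ψ (fun _ => ξ) (fun _ => ξ) (Summable.of_finite) fun x => ?_
    exact hasSum_unique fun _ : Unit => inner ℂ ξ (x ξ)
  have hn : (0 : ℝ) < ‖ξ‖ ^ 2 := by positivity
  -- The tolerance is chosen so that `⟨ξ, · ξ⟩` moves by at most `‖ξ‖² / 2` on the projection, which
  -- excludes a jump from `‖ξ‖²` to `0`.
  have hb : (0 : ℝ) < ‖ξ‖ ^ 2 / 2 / (‖block z (1 : (S.A n).H z →L[ℂ] (S.A n).H z)‖ + 1) := by
    positivity
  filter_upwards [S.α_continuous n _ (isNormalFunctional_comp hψ) 0 _ hb] with t ht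
  have hcent : ∀ a, S.α n t (block z 1) * a = a * S.α n t (block z 1) := by
    intro a
    obtain ⟨b, rfl⟩ := EquivLike.surjective (S.α n t) a
    rw [← map_mul, ← map_mul, block_one_mul]
  obtain ⟨r, hr⟩ := exists_comp_eq_smul hcent z
  have hidem : r • (1 : (S.A n).H z →L[ℂ] (S.A n).H z) = (r * r) • 1 := by
    have h1 : S.α n t (block z 1) * S.α n t (block z 1) = S.α n t (block z 1) := by
      rw [← map_mul, ← block_mul, one_mul]
    have h2 := congrArg (comp z) h1
    rw [comp_mul, hr, smul_mul_smul_comm, one_mul] at h2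
    exact h2.symm
  -- The component is an idempotent scalar, hence `0` or `1`; the continuity estimate decides.
  have hr' : r = r * r := smul_left_injective ℂ one_ne_zero hidem
  have h1 := ht (block z 1)
  rw [S.α_zero] at h1
  change ‖inner ℂ ξ (comp z (S.α n t (block z 1)) ξ) - inner ℂ ξ (comp z (block z 1) ξ)‖ ≤ _ at h1
  rw [hr, comp_block_self] at h1
  rcases mul_eq_zero.1 (show r * (r - 1) = 0 by linear_combination -hr') with h | h
  · exfalso
    rw [h, zero_smul, zero_apply, inner_zero_right, zero_sub, norm_neg,
      one_apply_eq_self, inner_self_eq_norm_sq_to_K] at h1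
    have h2 : ‖ξ‖ ^ 2 / 2 / (‖block z (1 : (S.A n).H z →L[ℂ] (S.A n).H z)‖ + 1) *
        ‖block z (1 : (S.A n).H z →L[ℂ] (S.A n).H z)‖ ≤ ‖ξ‖ ^ 2 / 2 := by
      rw [div_mul_eq_mul_div, div_le_iff₀ (by positivity)]
      nlinarith
    have h3 : ‖((‖ξ‖ : ℂ)) ^ 2‖ = ‖ξ‖ ^ 2 := by simp
    have h4 : ‖ξ‖ ^ 2 ≤ ‖ξ‖ ^ 2 / 2 := by
      rw [← h3]
      exact h1.trans (h2.trans_eq (by rw [h3]))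
    linarith
  · rw [hr, sub_eq_zero.1 h, one_smul]

/-- Minimal central projections are fixed by the flow. -/
lemma α_block_one (n : ℕ) (z : (S.A n).Z) (t : ℝ) : S.α n t (block z 1) = block z 1 := by
  have hfix : ∀ᶠ s in nhds (0 : ℝ), S.α n s (block z 1) = block z 1 := by
    have h0 := eventually_comp_α_block_one (S := S) n z
    -- With `p` the projection, small `s` gives `α_s(p) p = p`, while small `-s` gives `p α_s(p) =
    -- α_s(p)` after applying `α_s`. Centrality of `p` makes the two left sides equal.
    have h0' := (continuous_neg (G := ℝ)).tendsto' 0 0 neg_zero |>.eventually h0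
    have aux : ∀ s, comp z (S.α n s (block z 1)) = 1 →
        S.α n s (block z 1) * block z 1 = block z 1 := by
      intro s hs
      rw [← block_comp, hs]
    filter_upwards [h0, h0'] with s h1 h2
    have h3 := congrArg (S.α n s) (aux _ h2)
    have h4 : S.α n s (S.α n (-s) (block z 1)) = block z 1 := by
      simpa using S.α_symm n (-s) (block z 1)
    rw [map_mul, h4] at h3
    rw [← h3, block_one_mul, aux _ h1]
  have hnat : ∀ (s : ℝ), S.α n s (block z 1) = block z 1 →
      ∀ k : ℕ, S.α n (k * s) (block z 1) = block z 1 := by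
    intro s hs k
    induction k with
    | zero => simp [S.α_zero]
    | succ k ih => rw [Nat.cast_succ, add_mul, one_mul, S.α_add, hs, ih]
  -- An arbitrary time `t` is cut into `k + 1` equal steps, small enough to fix the projection.
  have hlim : Filter.Tendsto (fun k : ℕ => t / ((k : ℝ) + 1)) Filter.atTop (nhds 0) := by
    simpa [div_eq_mul_inv] using
      (tendsto_one_div_add_atTop_nhds_zero_nat (𝕜 := ℝ)).const_mul t
  obtain ⟨k, hk⟩ := (hlim.eventually hfix).exists
  have := hnat _ hk (k + 1)
  rwa [Nat.cast_succ, mul_div_cancel₀ _ (by positivity)] at this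

lemma comp_α (n : ℕ) (z : (S.A n).Z) (t : ℝ) (a : S.Alg n) :
    comp z (S.α n t a) = S.blockFlow n z t (comp z a) := by
  rw [blockFlow, block_comp, map_mul, α_block_one, comp_mul, comp_block_self, mul_one]

lemma α_block (n : ℕ) (z : (S.A n).Z) (t : ℝ) (x : (S.A n).H z →L[ℂ] (S.A n).H z) :
    S.α n t (block z x) = block z (S.blockFlow n z t x) := by
  rw [blockFlow, block_comp]
  conv_lhs => rw [← comp_block_self z x, block_comp, map_mul, α_block_one]

variable {β : ℝ}

/-! ### Uniqueness of KMS states and the conditional expectations -/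

namespace Admissible

variable (hβ : S.Admissible β)

lemma τ_unique {n : ℕ} {z : (S.A n).Z} {φ : ((S.A n).H z →L[ℂ] (S.A n).H z) →ₗ[ℂ] ℂ}
    (hφ : IsNormalKMSState (S.blockFlow n z) β φ) : φ = hβ.τ n z :=
  (hβ n z).unique hφ (hβ.τ_spec n z)

lemma τ_one (n : ℕ) (z : (S.A n).Z) : hβ.τ n z 1 = 1 := (hβ.τ_spec n z).2.1.1

/-- Positive normal KMS functionals are multiples of the KMS state. -/
lemma eq_smul_τ {n : ℕ} {z : (S.A n).Z} {φ : ((S.A n).H z →L[ℂ] (S.A n).H z) →ₗ[ℂ] ℂ}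
    (hn : IsNormal φ) (hp : ∀ x, 0 ≤ φ (star x * x)) (hk : IsKMS (S.blockFlow n z) β φ) :
    φ = φ 1 • hβ.τ n z := by
  obtain ⟨tn, ts, tk⟩ := hβ.τ_spec n z
  have h1 : 0 ≤ φ 1 := by simpa using hp 1
  obtain ⟨r, hr, hr'⟩ : ∃ r : ℝ, 0 ≤ r ∧ φ 1 = r := by
    rw [Complex.le_def] at h1
    exact ⟨(φ 1).re, h1.1, Complex.ext rfl h1.2.symm⟩
  have hc : (φ 1 + 1) ≠ 0 := by
    rw [hr']
    exact_mod_cast (by positivity : (r + 1 : ℝ) ≠ 0)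
  have hci : 0 ≤ (φ 1 + 1)⁻¹ := by
    rw [hr']
    exact_mod_cast (by positivity : 0 ≤ (r + 1 : ℝ)⁻¹)
  -- Adding `τ` before normalizing keeps the total mass `φ(1) + 1` nonzero, so that `φ(1) = 0` needs
  -- no separate argument.
  have key : IsNormalKMSState (S.blockFlow n z) β ((φ 1 + 1)⁻¹ • (φ + hβ.τ n z)) := by
    refine ⟨(hn.add tn).smul _, ⟨?_, fun x => ?_⟩, fun a b => ?_⟩
    · change (φ 1 + 1)⁻¹ * (φ 1 + hβ.τ n z 1) = 1
      rw [ts.1, inv_mul_cancel₀ hc]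
    · exact mul_nonneg hci (add_nonneg (hp x) (ts.2 x))
    · obtain ⟨F, h1, ⟨C, h2⟩, h3, h4⟩ := hk a b
      obtain ⟨G, k1, ⟨D, k2⟩, k3, k4⟩ := tk a b
      refine ⟨fun w => (φ 1 + 1)⁻¹ * (F w + G w), continuousOn_const.mul (h1.add k1),
        ⟨‖(φ 1 + 1)⁻¹‖ * (C + D), fun w hw hw' => ?_⟩,
        (h3.add k3).const_mul _, fun t => ?_⟩
      · rw [norm_mul]
        gcongr
        exact (norm_add_le _ _).trans (add_le_add (h2 w hw hw') (k2 w hw hw'))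
      · simp only [(h4 t).1, (h4 t).2, (k4 t).1, (k4 t).2]
        exact ⟨rfl, rfl⟩
  have h2 := hβ.τ_unique key
  have h3 : φ + hβ.τ n z = (φ 1 + 1) • hβ.τ n z := by
    conv_rhs => rw [← h2, smul_smul, mul_inv_cancel₀ hc, one_smul]
  rw [add_smul, one_smul] at h3
  exact add_right_cancel h3

/-- The value of `f ∈ 𝒵(A n)` at the minimal central projection `z`. -/
def ev (n : ℕ) (z : (S.A n).Z) : S.Zc n →ₗ[ℂ] ℂ :=
  hβ.τ n z ∘ₗ compₗ z ∘ₗ (S.A n).centerIncl.toAlgHom.toLinearMap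

lemma comp_centerIncl (n : ℕ) (z : (S.A n).Z) (f : S.Zc n) :
    comp z ((S.A n).centerIncl f) = hβ.ev n z f • 1 := by
  obtain ⟨r, hr⟩ := exists_comp_eq_smul (centerIncl_comm f) z
  have : hβ.ev n z f = r := by
    change hβ.τ n z (comp z ((S.A n).centerIncl f)) = r
    rw [hr, map_smul, τ_one, smul_eq_mul, mul_one]
  rw [this, hr]

lemma zc_ext {n : ℕ} {f g : S.Zc n} (h : ∀ z, hβ.ev n z f = hβ.ev n z g) : f = g :=
  (S.A n).centerIncl_injective (op_ext fun z => by
    rw [hβ.comp_centerIncl, hβ.comp_centerIncl, h])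

lemma ev_E (n : ℕ) (z : (S.A n).Z) (a : S.Alg n) :
    hβ.ev n z (hβ.E n a) = hβ.τ n z (comp z a) := by
  change hβ.τ n z (comp z ((S.A n).centerIncl (hβ.E n a))) = _
  rw [E_apply, map_smul, τ_one, smul_eq_mul, mul_one]

lemma E_centerIncl (n : ℕ) (f : S.Zc n) : hβ.E n ((S.A n).centerIncl f) = f :=
  hβ.zc_ext fun z => by rw [ev_E]; rfl

lemma ev_one (n : ℕ) (z : (S.A n).Z) : hβ.ev n z 1 = 1 := by
  rw [← hβ.E_one, ev_E, comp_one, τ_one]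

lemma ev_mul (n : ℕ) (z : (S.A n).Z) (f g : S.Zc n) :
    hβ.ev n z (f * g) = hβ.ev n z f * hβ.ev n z g := by
  change hβ.τ n z (comp z ((S.A n).centerIncl (f * g))) = _
  rw [map_mul, comp_mul, hβ.comp_centerIncl, hβ.comp_centerIncl, smul_mul_smul_comm, one_mul,
    map_smul, τ_one, smul_eq_mul, mul_one]

lemma ev_star (n : ℕ) (z : (S.A n).Z) (f : S.Zc n) :
    hβ.ev n z (star f) = star (hβ.ev n z f) := by
  change hβ.τ n z (comp z ((S.A n).centerIncl (star f))) = _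
  rw [map_star, comp_star, hβ.comp_centerIncl, star_smul, star_one, map_smul, τ_one, smul_eq_mul,
    mul_one]

lemma norm_ev_le (n : ℕ) (z : (S.A n).Z) (f : S.Zc n) :
    ‖hβ.ev n z f‖ ≤ ‖(S.A n).centerIncl f‖ :=
  ((hβ.τ_spec n z).2.1.norm_le _).trans (norm_comp_le z _)

/-- The element of `𝒵(A n)` with prescribed values. -/
lemma exists_ev_eq (n : ℕ) (c : (S.A n).Z → ℂ) (C : ℝ) (hC : ∀ z, ‖c z‖ ≤ C) :
    ∃ f : S.Zc n, ∀ z, hβ.ev n z f = c z := by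
  refine ⟨hβ.E n (ofFamily (fun z => c z • 1) C fun z => ?_), fun z => ?_⟩
  · rw [norm_smul, norm_one, mul_one]
    exact hC z
  · rw [ev_E, comp_ofFamily, map_smul, τ_one, smul_eq_mul, mul_one]

/-- If `j : A m → A n` is a normal equivariant `*`-homomorphism and `c` is positive and commutes
with its range, then `E_n(j(a) c) = E_n(j(E_m(a)) c)`. -/
lemma E_comp_mul_star_mul_self {m n : ℕ} (j : S.Alg m →⋆ₐ[ℂ] S.Alg n)
    (hj : IsNormalMap j.toAlgHom.toLinearMap) (hα : ∀ t a, j (S.α m t a) = S.α n t (j a))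
    (d : S.Alg n) (hd : ∀ a, d * j a = j a * d) (a : S.Alg m) :
    hβ.E n (j a * (star d * d)) =
      hβ.E n (j ((S.A m).centerIncl (hβ.E m a)) * (star d * d)) := by
  set c := star d * d with hc
  have hd' : ∀ a, star d * j a = j a * star d := by
    intro a
    have := congrArg star (hd (star a))
    rw [star_mul, star_mul, map_star, star_star] at this
    exact this.symm
  have hcc : ∀ a, c * j a = j a * c := fun a => by
    rw [hc, mul_assoc, hd, ← mul_assoc, hd', mul_assoc]
  refine hβ.zc_ext fun w => ?_
  rw [ev_E, ev_E]
  obtain ⟨tn, ts, tk⟩ := hβ.τ_spec n w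
  let Ψ : S.Alg m →ₗ[ℂ] ℂ :=
    ((hβ.τ n w ∘ₗ compₗ w) ∘ₗ LinearMap.mulRight ℂ c) ∘ₗ j.toAlgHom.toLinearMap
  have hΨ : (S.A m).IsNormalFunctional Ψ := hj _ ((isNormalFunctional_comp tn).mul_right c)
  have hΨ' : ∀ a, Ψ a = hβ.τ n w (comp w (j a * c)) := fun _ => rfl
  -- On each block, `Ψ` is a positive normal KMS functional, hence a multiple of the unique KMS
  -- state.
  have key : ∀ z x, Ψ (block z x) = Ψ (block z 1) * hβ.τ m z x := by
    intro z x
    have h := hβ.eq_smul_τ (hΨ.comp_block z) (fun x => ?_) (fun x y => ?_)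
    · exact congrArg (fun φ => φ x) h
    · have : j (block z (star x * x)) * c = star (j (block z x) * d) * (j (block z x) * d) := by
        rw [block_mul, block_star, star_mul, ← map_star, mul_assoc (star d), ← mul_assoc (j _) (j _),
          ← map_mul, ← mul_assoc (star d), hd', mul_assoc]
      change 0 ≤ Ψ (block z (star x * x))
      rw [hΨ', this, comp_mul, comp_star]
      exact ts.2 _
    -- The KMS function of `τ_w` for the pair `(j(x) c, j(y))` also serves `Ψ`: equivariance of `j`
    -- handles the flow, and `c` can be moved past `j(y)`.
    · obtain ⟨F, h1, h2, h3, h4⟩ := tk (comp w (j (block z x) * c)) (comp w (j (block z y)))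
      refine ⟨F, h1, h2, h3, fun t => ?_⟩
      rw [(h4 t).1, (h4 t).2, ← comp_α, ← hα, α_block, ← comp_mul, ← comp_mul]
      change _ = Ψ (block z _) ∧ _ = Ψ (block z _)
      rw [hΨ', hΨ', block_mul, block_mul, map_mul, map_mul]
      constructor
      · rw [mul_assoc, hcc, mul_assoc]
      · rw [mul_assoc]
  -- Each block of `a - E(a)` is annihilated by its `τ_z`; normality of `Ψ` passes from the blocks
  -- to the whole element.
  have := hΨ.eq_zero_of_block (a - (S.A m).centerIncl (hβ.E m a)) fun z => by
    have h1 : comp z (a - (S.A m).centerIncl (hβ.E m a)) =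
        comp z a - hβ.τ m z (comp z a) • 1 := by
      rw [← E_apply]; rfl
    rw [key, h1, map_sub, map_smul, τ_one, smul_eq_mul, mul_one, sub_self, mul_zero]
  rw [map_sub, sub_eq_zero] at this
  exact this

/-- If `j : A m → A n` is a normal equivariant `*`-homomorphism and `c` and its adjoint commute
with its range, then `E_n(j(a) c) = E_n(j(E_m(a)) c)`. -/
lemma E_comp_mul {m n : ℕ} (j : S.Alg m →⋆ₐ[ℂ] S.Alg n)
    (hj : IsNormalMap j.toAlgHom.toLinearMap) (hα : ∀ t a, j (S.α m t a) = S.α n t (j a))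
    (c : S.Alg n) (hc : ∀ a, c * j a = j a * c) (a : S.Alg m) :
    hβ.E n (j a * c) = hβ.E n (j ((S.A m).centerIncl (hβ.E m a)) * c) := by
  have h := fun s : ℂ => hβ.E_comp_mul_star_mul_self j hj hα (1 + s • c) (fun a => by
    rw [add_mul, mul_add, one_mul, mul_one, smul_mul_assoc, mul_smul_comm, hc]) a
  have h1 := h 1
  have h2 := h (-1)
  have h3 := h Complex.I
  have h4 := h (-Complex.I)
  rw [polarization_one c]
  simp only [mul_sub, mul_smul_comm, map_smul, map_sub, h1, h2, h3, h4]

end Admissible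

end FlowSequence

namespace FlowSequence

open AtomicAlg

variable {S : FlowSequence.{u, v}} {β : ℝ}

/-! ### Automorphisms that fix the center -/

lemma FixesCenter.block_one {n : ℕ} {γ : S.Alg n ≃⋆ₐ[ℂ] S.Alg n} (hγ : FixesCenter γ)
    (z : (S.A n).Z) : γ (block z 1) = block z 1 :=
  hγ ⟨block z 1, Subalgebra.mem_center_iff.2 fun b => (block_one_mul z b).symm⟩

lemma FixesCenter.symm {n : ℕ} {γ : S.Alg n ≃⋆ₐ[ℂ] S.Alg n} (hγ : FixesCenter γ) :
    FixesCenter γ.symm := fun f => by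
  conv_lhs => rw [← hγ f]
  exact γ.symm_apply_apply _

lemma FixesCenter.map_block {n : ℕ} {γ : S.Alg n ≃⋆ₐ[ℂ] S.Alg n} (hγ : FixesCenter γ)
    (z : (S.A n).Z) (x : (S.A n).H z →L[ℂ] (S.A n).H z) :
    γ (block z x) = block z (comp z (γ (block z x))) := by
  rw [block_comp]
  conv_lhs => rw [← mul_one x, block_mul, map_mul, hγ.block_one]

lemma FixesCenter.comp_map {n : ℕ} {γ : S.Alg n ≃⋆ₐ[ℂ] S.Alg n} (hγ : FixesCenter γ)
    (z : (S.A n).Z) (a : S.Alg n) :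
    comp z (γ a) = comp z (γ (block z (comp z a))) := by
  rw [block_comp, map_mul, hγ.block_one, comp_mul, comp_block_self, mul_one]

/-- The restriction to a block of an automorphism that fixes the center. -/
def FixesCenter.blockEquiv {n : ℕ} {γ : S.Alg n ≃⋆ₐ[ℂ] S.Alg n} (hγ : FixesCenter γ)
    (z : (S.A n).Z) : ((S.A n).H z →L[ℂ] (S.A n).H z) ≃⋆ₐ[ℂ] ((S.A n).H z →L[ℂ] (S.A n).H z) where
  toFun x := comp z (γ (block z x))
  invFun x := comp z (γ.symm (block z x))
  left_inv x := by
    dsimp only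
    rw [← hγ.map_block]
    exact (congrArg (comp z) (γ.symm_apply_apply _)).trans (comp_block_self z x)
  right_inv x := by
    dsimp only
    rw [← hγ.symm.map_block]
    exact (congrArg (comp z) (γ.apply_symm_apply _)).trans (comp_block_self z x)
  map_mul' x y := by rw [block_mul, map_mul, comp_mul]
  map_add' x y := by rw [block_add, map_add, comp_add]
  map_star' x := by rw [block_star, map_star, comp_star]
  map_smul' c x := by rw [block_smul, map_smul, comp_smul]

/-- A `*`-automorphism of `B(E)` is conjugation by a unitary, which can be moved onto the vectors
defining `τ`. -/
lemma isNormal_comp_starAlgEquiv {E : Type v} [NormedAddCommGroup E] [InnerProductSpace ℂ E]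
    [CompleteSpace E] (γ : (E →L[ℂ] E) ≃⋆ₐ[ℂ] (E →L[ℂ] E)) {τ : (E →L[ℂ] E) →ₗ[ℂ] ℂ}
    (hτ : IsNormal τ) : IsNormal (τ ∘ₗ γ.toAlgEquiv.toLinearMap) := by
  obtain ⟨U, rfl⟩ := γ.eq_linearIsometryEquivConjStarAlgEquiv (map_continuous γ)
  obtain ⟨ξ, η, hs, h⟩ := hτ
  refine ⟨fun k => U.symm (ξ k), fun k => U.symm (η k), by simpa using hs, fun x => ?_⟩
  refine hasSum_of_eq (fun k => ?_) (h (U.conjStarAlgEquiv x))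
  rw [LinearIsometryEquiv.conjStarAlgEquiv_apply_apply, ← U.symm.inner_map_map (ξ k),
    U.symm_apply_apply]

namespace Admissible

variable (hβ : S.Admissible β)

/-- The conditional expectations are invariant under automorphisms that fix the center and commute
with the flow. -/
lemma E_fixesCenter {n : ℕ} {γ : S.Alg n ≃⋆ₐ[ℂ] S.Alg n} (hγ : FixesCenter γ)
    (hα : ∀ t a, γ (S.α n t a) = S.α n t (γ a)) (a : S.Alg n) : hβ.E n (γ a) = hβ.E n a := by
  refine hβ.zc_ext fun z => ?_
  rw [ev_E, ev_E, hγ.comp_map]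
  obtain ⟨tn, ts, tk⟩ := hβ.τ_spec n z
  -- The state `τ_z ∘ γ` is again a normal KMS state, because `γ` commutes with the flow; uniqueness
  -- identifies it with `τ_z`.
  have key : IsNormalKMSState (S.blockFlow n z) β
      (hβ.τ n z ∘ₗ (hγ.blockEquiv z).toAlgEquiv.toLinearMap) := by
    refine ⟨isNormal_comp_starAlgEquiv _ tn, ⟨?_, fun x => ?_⟩, fun a b => ?_⟩
    · change hβ.τ n z (hγ.blockEquiv z 1) = 1
      rw [map_one, ts.1]
    · change 0 ≤ hβ.τ n z (hγ.blockEquiv z _)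
      rw [map_mul, show hγ.blockEquiv z (star x) = star (hγ.blockEquiv z x) from
        (hγ.blockEquiv z).map_star' x]
      exact ts.2 _
    · obtain ⟨F, h1, h2, h3, h4⟩ := tk (hγ.blockEquiv z a) (hγ.blockEquiv z b)
      refine ⟨F, h1, h2, h3, fun t => ?_⟩
      have hc : S.blockFlow n z t (hγ.blockEquiv z b) = hγ.blockEquiv z (S.blockFlow n z t b) := by
        change S.blockFlow n z t (comp z (γ (block z b))) = comp z (γ (block z _))
        rw [← comp_α, ← hα, α_block]
      rw [(h4 t).1, (h4 t).2, hc, ← map_mul, ← map_mul]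
      exact ⟨rfl, rfl⟩
  exact congrArg (fun φ => φ (comp z a)) (hβ.τ_unique key)

end Admissible

/-! ### Expectations of tensor products -/

namespace LeftMult

variable (L : S.LeftMult) (hβ : S.Admissible β)

/-- The product `ι(a ⊗ b)`. -/
def tm {m n k : ℕ} (h : m + n = k) (a : S.Alg m) (b : S.Alg n) : S.Alg k :=
  L.ι h (tmul _ _ a b)

lemma tm_mul {m n k : ℕ} (h : m + n = k) (a a' : S.Alg m) (b b' : S.Alg n) :
    L.tm h (a * a') (b * b') = L.tm h a b * L.tm h a' b' := by
  rw [tm, tmul_mul, map_mul]; rfl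

lemma tm_star {m n k : ℕ} (h : m + n = k) (a : S.Alg m) (b : S.Alg n) :
    L.tm h (star a) (star b) = star (L.tm h a b) := by
  rw [tm, tmul_star, map_star]; rfl

lemma tm_one {m n k : ℕ} (h : m + n = k) : L.tm h 1 1 = 1 := by
  rw [tm, tmul_one, map_one]

/-- The `*`-homomorphism `a ↦ ι(a ⊗ 1)`. -/
def tmLeft {m n k : ℕ} (h : m + n = k) : S.Alg m →⋆ₐ[ℂ] S.Alg k where
  toFun a := L.tm h a 1
  map_one' := L.tm_one h
  map_mul' a b := by rw [← tm_mul, one_mul]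
  map_zero' := by rw [tm, map_zero, LinearMap.zero_apply, map_zero]
  map_add' a b := by rw [tm, map_add, LinearMap.add_apply, map_add]; rfl
  commutes' r := by
    rw [Algebra.algebraMap_eq_smul_one, Algebra.algebraMap_eq_smul_one, tm, map_smul,
      LinearMap.smul_apply, map_smul]
    exact congrArg _ (L.tm_one h)
  map_star' a := by rw [← tm_star, star_one]

lemma tmLeft_apply {m n k : ℕ} (h : m + n = k) (a : S.Alg m) : L.tmLeft h a = L.tm h a 1 := rfl

lemma tmLeft_injective {m n k : ℕ} (h : m + n = k) : Function.Injective (L.tmLeft h) :=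
  fun _ _ hab => tmul_one_injective (L.ι_injective h hab)

lemma isNormalMap_tmLeft {m n k : ℕ} (h : m + n = k) :
    IsNormalMap (L.tmLeft h).toAlgHom.toLinearMap := fun φ hφ =>
  isNormalMap_tmul_one (A := S.A m) (B := S.A n) _ (L.ι_normal h φ hφ)

lemma tmLeft_α {m n k : ℕ} (h : m + n = k) (t : ℝ) (a : S.Alg m) :
    L.tmLeft h (S.α m t a) = S.α k t (L.tmLeft h a) := by
  have := L.flow h t a 1
  rw [map_one] at this
  exact this

/-- The elements `ι(a ⊗ 1)` and `ι(1 ⊗ b)` commute and have product `ι(a ⊗ b)`, so `E_comp_mul`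
applies to the first leg. No exchange property is needed on this side. -/
lemma E_tm_left {m n k : ℕ} (h : m + n = k) (a : S.Alg m) (b : S.Alg n) :
    hβ.E k (L.tm h a b) = hβ.E k (L.tm h ((S.A m).centerIncl (hβ.E m a)) b) := by
  have := hβ.E_comp_mul (L.tmLeft h) (L.isNormalMap_tmLeft h) (L.tmLeft_α h) (L.tm h 1 b)
    (fun a => by rw [tmLeft_apply, ← tm_mul, ← tm_mul, one_mul, mul_one, one_mul, mul_one]) a
  rwa [tmLeft_apply, tmLeft_apply, ← tm_mul, ← tm_mul, one_mul, mul_one, mul_one] at this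

variable {L}

/-- Under property (c), `E(ι(a ⊗ f)) = E(ι(f ⊗ γ(a)))` for some automorphism `γ` with
`E ∘ γ = E`. -/
lemma PropertyC.exists_swap (hc : L.PropertyC) {m n k : ℕ} (h : m + n = k) (h' : n + m = k) :
    ∃ (γ₁ : S.Alg m ≃⋆ₐ[ℂ] S.Alg m) (γ₂ : S.Alg n ≃⋆ₐ[ℂ] S.Alg n),
      FixesCenter γ₁ ∧ FixesCenter γ₂ ∧ (∀ b, hβ.E n (γ₂ b) = hβ.E n b) ∧
      ∀ a b, hβ.E k (L.tm h a b) = hβ.E k (L.tm h' (γ₂ b) (γ₁ a)) := by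
  obtain ⟨γ, γ₁, γ₂, ⟨hγ, h₁, h₂⟩, hsw, hα⟩ := hc h h'
  have hsw' : ∀ a b, γ (L.tm h a b) = L.tm h' (γ₂ b) (γ₁ a) := hsw
  refine ⟨γ₁, γ₂, h₁, h₂, hβ.E_fixesCenter h₂ fun t b => ?_, fun a b => ?_⟩
  -- Property (c) does not include that `γ₂` commutes with the flow. This follows from `ι(γ₂(b) ⊗ 1)
  -- = γ(ι(1 ⊗ b))`, as `γ` commutes with the flow and `ι(· ⊗ 1)` is injective and equivariant.
  · apply L.tmLeft_injective h'
    have e : ∀ b, L.tmLeft h' (γ₂ b) = γ (L.tm h 1 b) := fun b => by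
      rw [hsw', map_one, tmLeft_apply]
    rw [L.tmLeft_α, e, e, ← hα]
    have := L.flow h t 1 b
    rw [map_one] at this
    exact congrArg γ this
  · rw [← hsw', hβ.E_fixesCenter hγ hα]

/-- After an exchange of the factors this is `E_tm_left`; the twist `γ₂` disappears because it
preserves `E` and fixes the central element `E(b)`. -/
lemma PropertyC.E_tm_right (hc : L.PropertyC) {m n k : ℕ} (h : m + n = k) (a : S.Alg m)
    (b : S.Alg n) : hβ.E k (L.tm h a b) = hβ.E k (L.tm h a ((S.A n).centerIncl (hβ.E n b))) := by
  have h' : n + m = k := by omega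
  obtain ⟨γ₁, γ₂, h₁, h₂, hE, hs⟩ := hc.exists_swap hβ h h'
  rw [hs, hs, E_tm_left, hE, h₂]

/-- The product `E(ι(f ⊗ g))` of central elements, with a flexible index. -/
def pr (L : S.LeftMult) (hβ : S.Admissible β) {m n k : ℕ} (h : m + n = k) (f : S.Zc m)
    (g : S.Zc n) : S.Zc k :=
  hβ.E k (L.tm h ((S.A m).centerIncl f) ((S.A n).centerIncl g))

lemma prod_eq_pr (m n : ℕ) (f : S.Zc m) (g : S.Zc n) : L.prod hβ m n f g = L.pr hβ rfl f g := rfl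

lemma PropertyC.pr_comm (hc : L.PropertyC) {m n k : ℕ} (h : m + n = k) (h' : n + m = k)
    (f : S.Zc m) (g : S.Zc n) : L.pr hβ h f g = L.pr hβ h' g f := by
  obtain ⟨γ₁, γ₂, h₁, h₂, hE, hs⟩ := hc.exists_swap hβ h h'
  rw [pr, hs, h₁, h₂]; rfl

/-- The inner expectation is removed on the left by `E_tm_left` and on the right by `E_tm_right`;
what remains is (m2). -/
lemma PropertyC.pr_assoc (hc : L.PropertyC) {l m n lm mn k : ℕ} (h₁ : l + m = lm)
    (h₂ : lm + n = k) (h₃ : m + n = mn) (h₄ : l + mn = k) (f : S.Zc l) (g : S.Zc m) (e : S.Zc n) :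
    L.pr hβ h₂ (L.pr hβ h₁ f g) e = L.pr hβ h₄ f (L.pr hβ h₃ g e) := by
  rw [pr, pr, pr, ← E_tm_left, pr, ← hc.E_tm_right]
  exact congrArg _ (L.assoc h₁ h₂ h₃ h₄ _ _ _)

lemma pr_one_left (n : ℕ) (f : S.Zc n) : L.pr hβ (zero_add n) 1 f = f := by
  have h1 := L.zero_left 1 ((S.A n).centerIncl f)
  rw [RingHom.map_one, one_smul] at h1
  have h2 : L.tm (zero_add n) ((S.A 0).centerIncl 1) ((S.A n).centerIncl f) =
      (S.A n).centerIncl f := by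
    rw [map_one (S.A 0).centerIncl]
    exact h1
  rw [pr, h2, hβ.E_centerIncl]

/-- This is condition (L). It makes compatibility with the transition maps a special case of
associativity. -/
lemma Θsucc_eq_pr (n : ℕ) (f : S.Zc n) : hβ.Θsucc n f = L.pr hβ rfl f (1 : S.Zc 1) := by
  change hβ.E (n + 1) (S.incl n ((S.A n).centerIncl f)) = _
  rw [L.incl_eq, pr, map_one (S.A 1).centerIncl]; rfl

lemma PropertyC.pr_Θsucc (hc : L.PropertyC) {m n k : ℕ} (h : m + n = k) (f : S.Zc m)
    (g : S.Zc n) : L.pr hβ (by omega) f (hβ.Θsucc n g) = hβ.Θsucc k (L.pr hβ h f g) := by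
  rw [Θsucc_eq_pr (L := L), Θsucc_eq_pr (L := L), hc.pr_assoc hβ h rfl rfl]

end LeftMult

end FlowSequence

namespace FlowSequence

variable {S : FlowSequence.{u, v}} {β : ℝ}

/-- The linear map on `S̈(α, β)` that is induced by a compatible family. -/
def Admissible.liftRepSys (hβ : S.Admissible β) {P : Type*} [AddCommMonoid P] [Module ℂ P]
    (g : ∀ n, S.Zc n →ₗ[ℂ] P) (hg : ∀ m n h f, g n (hβ.Θ m n h f) = g m f) :
    hβ.RepSys →ₗ[ℂ] P :=
  Module.DirectLimit.lift ℂ ℕ S.Zc hβ.Θ g hg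

lemma Admissible.liftRepSys_toRepSys (hβ : S.Admissible β) {P : Type*} [AddCommMonoid P]
    [Module ℂ P] (g : ∀ n, S.Zc n →ₗ[ℂ] P) (hg : ∀ m n h f, g n (hβ.Θ m n h f) = g m f) (n : ℕ)
    (f : S.Zc n) : hβ.liftRepSys g hg (hβ.toRepSys n f) = g n f :=
  Module.DirectLimit.lift_of (R := ℂ) (G := S.Zc) (f := hβ.Θ) g hg f

/-! ### The algebra `Σ(α, β)` -/

lemma dsum_induction {p : S.DSum → Prop} (x : S.DSum) (zero : p 0)
    (of : ∀ n f, p (S.toDSum n f)) (add : ∀ x y, p x → p y → p (x + y)) : p x :=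
  DirectSum.induction_on x zero of add

namespace LeftMult

variable {L : S.LeftMult} (hβ : S.Admissible β)

/-- The free index `k` lets both sides of an identity be written in one summand, without transport
along equalities of natural numbers. -/
lemma toDSum_pr {m n k : ℕ} (h : m + n = k) (f : S.Zc m) (g : S.Zc n) :
    S.toDSum k (L.pr hβ h f g) = L.mulDSum hβ (S.toDSum m f) (S.toDSum n g) := by
  subst h
  rw [mulDSum_apply, prod_eq_pr]

lemma PropertyC.isUnitalCommAlgebra_mulDSum (hc : L.PropertyC) :
    IsUnitalCommAlgebra (L.mulDSum hβ) (S.oneDSum 0) where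
  mul_assoc x y z := by
    induction x using dsum_induction with
    | zero => simp
    | add x x' hx hx' => simp only [map_add, LinearMap.add_apply, hx, hx']
    | of l f =>
    induction y using dsum_induction with
    | zero => simp
    | add x x' hx hx' => simp only [map_add, LinearMap.add_apply, hx, hx']
    | of m g =>
    induction z using dsum_induction with
    | zero => simp
    | add x x' hx hx' => simp only [map_add, hx, hx']
    | of n e =>
    rw [← toDSum_pr hβ rfl, ← toDSum_pr hβ rfl, ← toDSum_pr hβ rfl,
      ← toDSum_pr hβ (add_assoc l m n).symm, hc.pr_assoc hβ rfl rfl rfl]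
  mul_comm x y := by
    induction x using dsum_induction with
    | zero => simp
    | add x x' hx hx' => simp only [map_add, LinearMap.add_apply, hx, hx']
    | of l f =>
    induction y using dsum_induction with
    | zero => simp
    | add x x' hx hx' => simp only [map_add, LinearMap.add_apply, hx, hx']
    | of m g =>
    rw [← toDSum_pr hβ rfl, ← toDSum_pr hβ (add_comm m l), hc.pr_comm hβ rfl]
  one_mul x := by
    induction x using dsum_induction with
    | zero => simp
    | add x x' hx hx' => simp only [map_add, hx, hx']
    | of l f => rw [oneDSum, ← toDSum_pr hβ (zero_add l), pr_one_left]

/-! ### The multiplication of `S̈(α, β)` -/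

lemma toRepSys_pr {m n k : ℕ} (h : m + n = k) (f : S.Zc m) (g : S.Zc n) :
    hβ.toRepSys k (L.pr hβ h f g) = hβ.toRepSys (m + n) (L.prod hβ m n f g) := by
  subst h; rfl

lemma toRepSys_Θsucc (n : ℕ) (f : S.Zc n) :
    hβ.toRepSys (n + 1) (hβ.Θsucc n f) = hβ.toRepSys n f := by
  rw [← hβ.toRepSys_Θ n (n + 1) n.le_succ, hβ.Θ_succ n n le_rfl, Admissible.Θ_self,
    LinearMap.id_apply]

lemma PropertyC.toRepSys_prod_Θ (hc : L.PropertyC) (m : ℕ) (f : S.Zc m) {n k : ℕ} (h : n ≤ k)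
    (g : S.Zc n) : hβ.toRepSys (m + k) (L.prod hβ m k f (hβ.Θ n k h g)) =
      hβ.toRepSys (m + n) (L.prod hβ m n f g) := by
  induction k, h using Nat.le_induction with
  | base => rw [Admissible.Θ_self, LinearMap.id_apply]
  | succ k h ih =>
    rw [hβ.Θ_succ n k h, ← ih, ← toRepSys_Θsucc hβ (m + k), prod_eq_pr, prod_eq_pr,
      ← hc.pr_Θsucc hβ rfl]
    rfl

/-- The action of `𝒵(A m)` on `S̈(α, β)`. -/
def actRepSys (hc : L.PropertyC) (m : ℕ) : S.Zc m →ₗ[ℂ] hβ.RepSys →ₗ[ℂ] hβ.RepSys :=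
  LinearMap.flip <| hβ.liftRepSys
    (fun n => ((L.prod hβ m n).compr₂ (hβ.toRepSys (m + n))).flip)
    fun _ _ h g => LinearMap.ext fun f => hc.toRepSys_prod_Θ hβ m f h g

lemma actRepSys_toRepSys (hc : L.PropertyC) (m n : ℕ) (f : S.Zc m) (g : S.Zc n) :
    actRepSys hβ hc m f (hβ.toRepSys n g) = hβ.toRepSys (m + n) (L.prod hβ m n f g) :=
  LinearMap.congr_fun (hβ.liftRepSys_toRepSys
    (fun n => ((L.prod hβ m n).compr₂ (hβ.toRepSys (m + n))).flip)
    (fun _ _ h g => LinearMap.ext fun f => hc.toRepSys_prod_Θ hβ m f h g) n g) f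

/-- Commutativity turns invariance in the second variable into invariance in the first. -/
lemma actRepSys_Θ (hc : L.PropertyC) (m n : ℕ) (h : m ≤ n) (f : S.Zc m) :
    actRepSys hβ hc n (hβ.Θ m n h f) = actRepSys hβ hc m f :=
  LinearMap.ext fun x => by
    obtain ⟨k, g, rfl⟩ := hβ.exists_toRepSys x
    rw [actRepSys_toRepSys, actRepSys_toRepSys, ← toRepSys_pr hβ rfl, ← toRepSys_pr hβ rfl,
      hc.pr_comm hβ rfl (add_comm k n), hc.pr_comm hβ rfl (add_comm k m), toRepSys_pr,
      toRepSys_pr, hc.toRepSys_prod_Θ]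

/-- The multiplication of `S̈(α, β)`. -/
def mulRepSys (hc : L.PropertyC) : hβ.RepSys →ₗ[ℂ] hβ.RepSys →ₗ[ℂ] hβ.RepSys :=
  hβ.liftRepSys (actRepSys hβ hc) (actRepSys_Θ hβ hc)

lemma mulRepSys_toRepSys (hc : L.PropertyC) {m n k : ℕ} (h : m + n = k) (f : S.Zc m)
    (g : S.Zc n) : mulRepSys hβ hc (hβ.toRepSys m f) (hβ.toRepSys n g) =
      hβ.toRepSys k (L.pr hβ h f g) := by
  rw [toRepSys_pr, ← actRepSys_toRepSys hβ hc]
  exact LinearMap.congr_fun (hβ.liftRepSys_toRepSys (actRepSys hβ hc) (actRepSys_Θ hβ hc) m f) _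

/-- The canonical map `Σ(α, β) → S̈(α, β)`. -/
def projRepSys : S.DSum →ₗ[ℂ] hβ.RepSys := DirectSum.toModule ℂ ℕ hβ.RepSys hβ.toRepSys

lemma projRepSys_toDSum (n : ℕ) (f : S.Zc n) :
    projRepSys hβ (S.toDSum n f) = hβ.toRepSys n f := DirectSum.toModule_lof _ _ _

lemma isUnitalCommAlgebra_mulRepSys (hc : L.PropertyC) :
    IsUnitalCommAlgebra (mulRepSys hβ hc) hβ.unitRepSys where
  mul_assoc x y z := by
    obtain ⟨l, f, rfl⟩ := hβ.exists_toRepSys x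
    obtain ⟨m, g, rfl⟩ := hβ.exists_toRepSys y
    obtain ⟨n, e, rfl⟩ := hβ.exists_toRepSys z
    rw [mulRepSys_toRepSys hβ hc rfl, mulRepSys_toRepSys hβ hc rfl, mulRepSys_toRepSys hβ hc rfl,
      mulRepSys_toRepSys hβ hc (add_assoc l m n).symm, hc.pr_assoc hβ rfl rfl rfl]
  mul_comm x y := by
    obtain ⟨l, f, rfl⟩ := hβ.exists_toRepSys x
    obtain ⟨m, g, rfl⟩ := hβ.exists_toRepSys y
    rw [mulRepSys_toRepSys hβ hc rfl, mulRepSys_toRepSys hβ hc (add_comm m l), hc.pr_comm hβ rfl]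
  one_mul x := by
    obtain ⟨l, f, rfl⟩ := hβ.exists_toRepSys x
    rw [Admissible.unitRepSys, mulRepSys_toRepSys hβ hc (zero_add l), pr_one_left]

lemma projRepSys_mul (hc : L.PropertyC) (x y : S.DSum) :
    projRepSys hβ (L.mulDSum hβ x y) =
      mulRepSys hβ hc (projRepSys hβ x) (projRepSys hβ y) := by
  induction x using dsum_induction with
  | zero => simp
  | add x x' hx hx' => simp only [map_add, LinearMap.add_apply, hx, hx']
  | of l f =>
  induction y using dsum_induction with
  | zero => simp
  | add x x' hx hx' => simp only [map_add, hx, hx']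
  | of m g =>
  rw [← toDSum_pr hβ rfl, projRepSys_toDSum, projRepSys_toDSum, projRepSys_toDSum,
    mulRepSys_toRepSys]

lemma projRepSys_surjective : Function.Surjective (projRepSys hβ) := fun x => by
  obtain ⟨n, f, rfl⟩ := hβ.exists_toRepSys x
  exact ⟨S.toDSum n f, projRepSys_toDSum hβ n f⟩

/-- A surjective homomorphism from `Σ(α, β)` onto a unital commutative algebra defines a left
action. -/
lemma isLeftAction_of_surj {V : Type*} [AddCommMonoid V] [Module ℂ V] {T : ∀ n, S.Zc n →ₗ[ℂ] V}
    {mul : V →ₗ[ℂ] V →ₗ[ℂ] V} {one : V} (hV : IsUnitalCommAlgebra mul one) {π : S.DSum →ₗ[ℂ] V}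
    (hπ : IsSurjAlgHom (L.mulDSum hβ) (S.oneDSum 0) mul one π)
    (hT : ∀ n f, π (S.toDSum n f) = T n f) :
    L.IsLeftAction hβ T (mul ∘ₗ π) ∧
      IsSurjAlgHom (L.mulDSum hβ) (S.oneDSum 0) mul one ((mul ∘ₗ π).flip one) := by
  -- The action is `x · s = π(x) s`, so acting on the unit recovers `π`.
  have hf : (mul ∘ₗ π).flip one = π := LinearMap.ext fun x => by
    rw [LinearMap.flip_apply, LinearMap.comp_apply, hV.mul_comm, hV.one_mul]
  refine ⟨⟨fun m n f g => ?_, fun s => ?_, fun x y s => ?_⟩, hf.symm ▸ hπ⟩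
  · rw [← hT, ← hT, LinearMap.comp_apply, ← hπ.map_mul, mulDSum_apply]
  · rw [LinearMap.comp_apply, hπ.map_one, hV.one_mul]
  · simp only [LinearMap.comp_apply]
    rw [hπ.map_mul, hV.mul_assoc]

lemma isSurjAlgHom_projRepSys (hc : L.PropertyC) :
    IsSurjAlgHom (L.mulDSum hβ) (S.oneDSum 0) (mulRepSys hβ hc) hβ.unitRepSys (projRepSys hβ) where
  map_mul := projRepSys_mul hβ hc
  map_one := projRepSys_toDSum hβ 0 1
  surjective := projRepSys_surjective hβ

end LeftMult

end FlowSequence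

/-! ## Positivity of matrices -/

/-- The Gram matrices of a positive hermitian functional are positive semidefinite. -/
lemma posSemidef_gram {R ι : Type*} [Ring R] [StarRing R] [Algebra ℂ R] [StarModule ℂ R]
    [Fintype ι] (ω : R →ₗ[ℂ] ℂ) (hs : ∀ a, ω (star a) = star (ω a))
    (hp : ∀ a, 0 ≤ ω (star a * a)) (X : ι → R) :
    (Matrix.of fun i j => ω (star (X i) * X j)).PosSemidef := by
  refine Matrix.PosSemidef.of_dotProduct_mulVec_nonneg ?_ fun x => ?_
  · ext i j
    rw [Matrix.conjTranspose_apply, Matrix.of_apply, Matrix.of_apply, ← hs, star_mul, star_star]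
  · convert hp (∑ i, x i • X i) using 1
    simp only [dotProduct, Matrix.mulVec, Matrix.of_apply, star_sum, star_smul, Finset.sum_mul,
      Finset.mul_sum, map_sum, smul_mul_assoc, mul_smul_comm, map_smul, smul_eq_mul, Pi.star_apply]
    rw [Finset.sum_comm]
    refine Finset.sum_congr rfl fun i _ => Finset.sum_congr rfl fun j _ => ?_
    ring

/-- `[[C, c], [c̄, C]]` is positive semidefinite for `|c| ≤ C`. -/
lemma posSemidef_two {C : ℝ} {c : ℂ} (h : ‖c‖ ≤ C) :
    (!![(C : ℂ), c; star c, (C : ℂ)]).PosSemidef := by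
  obtain ⟨u, hu, hcu⟩ : ∃ u : ℂ, u * star u = 1 ∧ c = ‖c‖ * u := by
    refine ⟨Complex.exp (c.arg * Complex.I), ?_, (Complex.norm_mul_exp_arg_mul_I c).symm⟩
    rw [Complex.star_def, Complex.mul_conj, Complex.normSq_eq_norm_sq, Complex.norm_exp_ofReal_mul_I]
    norm_num
  have h1 : (0 : ℂ) ≤ ((C - ‖c‖ : ℝ) : ℂ) := by exact_mod_cast sub_nonneg.2 h
  have h2 : (0 : ℂ) ≤ ((‖c‖ : ℝ) : ℂ) := by exact_mod_cast norm_nonneg c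
  -- The matrix is `(C - |c|) 1 + |c| v v^*` with `c = |c| u` and `v = (1, ū)`.
  have h3 := (Matrix.PosSemidef.one (n := Fin 2) (R := ℂ)).smul h1 |>.add
    ((Matrix.posSemidef_vecMulVec_self_star (![1, star u] : Fin 2 → ℂ)).smul h2)
  have hu' : star u * u = 1 := by rw [mul_comm, hu]
  convert h3 using 1
  ext i j
  fin_cases i <;> fin_cases j
  · simp [Matrix.vecMulVec]
  · simpa [Matrix.vecMulVec] using hcu
  · have := congrArg star hcu
    simpa [Matrix.vecMulVec] using this
  · simp only [Matrix.vecMulVec, Complex.star_def] at hu' ⊢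
    simp [hu']

namespace FlowSequence

open AtomicAlg

variable {S : FlowSequence.{u, v}} {β : ℝ}

namespace Admissible

variable (hβ : S.Admissible β) {k : ℕ}

/-- A matrix over `𝒵(A n)` is positive if all its values are positive semidefinite. -/
def IsPos {n : ℕ} (P : Matrix (Fin k) (Fin k) (S.Zc n)) : Prop :=
  ∀ z, (P.map (hβ.ev n z)).PosSemidef

lemma map_ev_conjTranspose_mul {n : ℕ} (G : Matrix (Fin k) (Fin k) (S.Zc n)) (z : (S.A n).Z) :
    (G.conjTranspose * G).map (hβ.ev n z) =
      (G.map (hβ.ev n z)).conjTranspose * G.map (hβ.ev n z) := by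
  ext i j
  simp only [Matrix.map_apply, Matrix.mul_apply, Matrix.conjTranspose_apply, map_sum, ev_mul,
    ev_star]

/-- The algebra `𝒵(A n)` consists of all bounded functions on the set of blocks, so factors can be
chosen pointwise, provided that they stay bounded. -/
lemma isPos_iff {n : ℕ} {P : Matrix (Fin k) (Fin k) (S.Zc n)} :
    hβ.IsPos P ↔ ∃ G : Matrix (Fin k) (Fin k) (S.Zc n), P = G.conjTranspose * G := by
  constructor
  · intro h
    have h' : ∀ z, ∃ B : Matrix (Fin k) (Fin k) ℂ, P.map (hβ.ev n z) = B.conjTranspose * B :=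
      fun z => by
        open scoped MatrixOrder in
        exact CStarAlgebra.nonneg_iff_eq_star_mul_self.1 (h z).nonneg
    choose B hB using h'
    -- The squared norm of column `j` of `B z` is the value of `P j j` at `z`, and `t ≤ 1 + t²`.
    have hb : ∀ i j z, ‖B z i j‖ ≤ 1 + ‖(S.A n).centerIncl (P j j)‖ := by
      intro i j z
      have h1 : hβ.ev n z (P j j) = ((∑ l, ‖B z l j‖ ^ 2 : ℝ) : ℂ) := by
        have := congrFun (congrFun (hB z) j) j
        rw [Matrix.map_apply, Matrix.mul_apply] at this
        rw [this, Complex.ofReal_sum]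
        refine Finset.sum_congr rfl fun l _ => ?_
        rw [Matrix.conjTranspose_apply, mul_comm, Complex.star_def, Complex.mul_conj,
          Complex.normSq_eq_norm_sq]
      have h2 := hβ.norm_ev_le n z (P j j)
      rw [h1, Complex.norm_real, Real.norm_of_nonneg (by positivity)] at h2
      have h3 : ‖B z i j‖ ^ 2 ≤ ∑ l, ‖B z l j‖ ^ 2 :=
        Finset.single_le_sum (f := fun l => ‖B z l j‖ ^ 2) (fun _ _ => by positivity)
          (Finset.mem_univ i)
      nlinarith [sq_nonneg (‖B z i j‖ - 1), norm_nonneg (B z i j)]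
    choose G hG using fun i j => hβ.exists_ev_eq n (fun z => B z i j) _ (hb i j)
    refine ⟨Matrix.of G, ?_⟩
    ext i j
    refine hβ.zc_ext fun z => ?_
    have h1 : (Matrix.of G).map (hβ.ev n z) = B z := by
      ext i j
      exact hG i j z
    have h2 := hβ.map_ev_conjTranspose_mul (Matrix.of G) z
    rw [h1, ← hB] at h2
    exact congrFun (congrFun h2.symm i) j
  · rintro ⟨G, rfl⟩ z
    rw [map_ev_conjTranspose_mul]
    exact Matrix.posSemidef_conjTranspose_mul_self _

lemma posRepSys_iff {X : Matrix (Fin k) (Fin k) hβ.RepSys} :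
    X ∈ hβ.posRepSys k ↔
      ∃ (n : ℕ) (P : Matrix (Fin k) (Fin k) (S.Zc n)), hβ.IsPos P ∧ X = P.map (hβ.toRepSys n) := by
  constructor
  · rintro ⟨n, G, rfl⟩
    exact ⟨n, _, hβ.isPos_iff.2 ⟨G, rfl⟩, rfl⟩
  · rintro ⟨n, P, hP, rfl⟩
    obtain ⟨G, rfl⟩ := hβ.isPos_iff.1 hP
    exact ⟨n, G, rfl⟩

lemma IsPos.add {n : ℕ} {P Q : Matrix (Fin k) (Fin k) (S.Zc n)} (hP : hβ.IsPos P)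
    (hQ : hβ.IsPos Q) : hβ.IsPos (P + Q) := fun z => by
  rw [Matrix.map_add _ (map_add _)]
  exact (hP z).add (hQ z)

lemma isPos_diagonal {r : ℝ} (hr : 0 ≤ r) (n : ℕ) :
    hβ.IsPos (Matrix.diagonal fun _ : Fin k => (r : ℂ) • (1 : S.Zc n)) := fun z => by
  rw [Matrix.diagonal_map (map_zero _)]
  refine Matrix.PosSemidef.diagonal fun i => ?_
  simp only [map_smul, ev_one, smul_eq_mul, mul_one, Pi.zero_apply]
  exact_mod_cast hr

/-- The unit for the Schur product; multiplying by it with entries in `𝒵(A 1)` realizes the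
transition maps entrywise. -/
lemma isPos_ones (n : ℕ) : hβ.IsPos (Matrix.of fun _ _ : Fin k => (1 : S.Zc n)) := fun z => by
  have := Matrix.posSemidef_vecMulVec_self_star (fun _ : Fin k => (1 : ℂ))
  convert this using 1
  ext i j
  simp [Matrix.vecMulVec, ev_one]

lemma isPos_two {n : ℕ} {f : S.Zc n} {C : ℝ} (h : ∀ z, ‖hβ.ev n z f‖ ≤ C) :
    hβ.IsPos !![(C : ℂ) • (1 : S.Zc n), f; star f, (C : ℂ) • (1 : S.Zc n)] := fun z => by
  convert posSemidef_two (h z) using 1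
  ext i j
  fin_cases i <;> fin_cases j <;> simp [ev_one, ev_star]

end Admissible

/-! ### Schur products and the matrix order -/

namespace LeftMult

variable (L : S.LeftMult) (hβ : S.Admissible β) {k : ℕ}

/-- The Schur product theorem for the multiplication of `Σ(α, β)`. -/
lemma isPos_schur {m n l : ℕ} (h : m + n = l) {P : Matrix (Fin k) (Fin k) (S.Zc m)}
    {Q : Matrix (Fin k) (Fin k) (S.Zc n)} (hP : hβ.IsPos P) (hQ : hβ.IsPos Q) :
    hβ.IsPos (Matrix.of fun i j => L.pr hβ h (P i j) (Q i j)) := by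
  obtain ⟨G, rfl⟩ := hβ.isPos_iff.1 hP
  obtain ⟨H, rfl⟩ := hβ.isPos_iff.1 hQ
  intro w
  obtain ⟨-, ts, -⟩ := hβ.τ_spec l w
  let X : Fin k → Fin k → Fin k → S.Alg l := fun a b i =>
    L.tm h ((S.A m).centerIncl (G a i)) ((S.A n).centerIncl (H b i))
  -- For each pair of rows `a` of `G` and `b` of `H`, the elements `ι(G_{ai} ⊗ H_{bi})` have a Gram
  -- matrix with respect to the state at `w`; the Schur product is the sum of these matrices.
  have key : (Matrix.of fun i j => L.pr hβ h ((G.conjTranspose * G) i j)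
      ((H.conjTranspose * H) i j)).map (hβ.ev l w) =
      ∑ a, ∑ b, Matrix.of fun i j => (hβ.τ l w ∘ₗ compₗ w) (star (X a b i) * X a b j) := by
    ext i j
    have e : ∀ a b, star (X a b i) * X a b j = L.tm h ((S.A m).centerIncl (star (G a i) * G a j))
        ((S.A n).centerIncl (star (H b i) * H b j)) := fun a b => by
      rw [map_mul, map_mul, tm_mul, map_star, map_star, tm_star]
    simp only [Matrix.map_apply, Matrix.of_apply, pr, Admissible.ev_E, Matrix.sum_apply, e,
      Matrix.mul_apply, Matrix.conjTranspose_apply, tm, map_sum, LinearMap.sum_apply]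
    exact Finset.sum_comm
  rw [key]
  refine Matrix.posSemidef_sum _ fun a _ => Matrix.posSemidef_sum _ fun b _ =>
    posSemidef_gram _ (fun x => ?_) (fun x => ?_) _
  · exact ts.map_star (comp w x)
  · exact ts.2 (comp w x)

lemma isPos_map_Θ (L : S.LeftMult) (hβ : S.Admissible β) {m n : ℕ} (h : m ≤ n)
    {P : Matrix (Fin k) (Fin k) (S.Zc m)} (hP : hβ.IsPos P) :
    hβ.IsPos (P.map (hβ.Θ m n h)) := by
  induction n, h using Nat.le_induction with
  | base => rwa [Admissible.Θ_self, LinearMap.id_coe, Matrix.map_id]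
  | succ n h ih =>
    convert L.isPos_schur hβ rfl ih (hβ.isPos_ones 1) using 1
    ext i j
    rw [Matrix.map_apply, Matrix.of_apply, hβ.Θ_succ m n h, Θsucc_eq_pr (L := L)]
    rfl

lemma posRepSys_add (L : S.LeftMult) (hβ : S.Admissible β)
    {X Y : Matrix (Fin k) (Fin k) hβ.RepSys} (hX : X ∈ hβ.posRepSys k)
    (hY : Y ∈ hβ.posRepSys k) : X + Y ∈ hβ.posRepSys k := by
  rw [Admissible.posRepSys_iff] at hX hY ⊢
  obtain ⟨m, P, hP, rfl⟩ := hX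
  obtain ⟨n, Q, hQ, rfl⟩ := hY
  refine ⟨max m n, _, Admissible.IsPos.add hβ (L.isPos_map_Θ hβ (le_max_left m n) hP)
    (L.isPos_map_Θ hβ (le_max_right m n) hQ), ?_⟩
  ext i j
  simp only [Matrix.map_apply, Matrix.add_apply, map_add, Admissible.toRepSys_Θ]

variable {L}

lemma posRepSys_schur (hc : L.PropertyC) {X Y : Matrix (Fin k) (Fin k) hβ.RepSys}
    (hX : X ∈ hβ.posRepSys k) (hY : Y ∈ hβ.posRepSys k) :
    (Matrix.of fun i j => mulRepSys hβ hc (X i j) (Y i j)) ∈ hβ.posRepSys k := by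
  rw [Admissible.posRepSys_iff] at hX hY ⊢
  obtain ⟨m, P, hP, rfl⟩ := hX
  obtain ⟨n, Q, hQ, rfl⟩ := hY
  refine ⟨m + n, _, L.isPos_schur hβ rfl hP hQ, ?_⟩
  ext i j
  exact mulRepSys_toRepSys hβ hc rfl _ _

end LeftMult

namespace Admissible

variable (hβ : S.Admissible β) {k : ℕ}

lemma diagonal_mem_posRepSys {r : ℝ} (hr : 0 ≤ r) :
    (Matrix.diagonal fun _ : Fin k => (r : ℂ) • hβ.unitRepSys) ∈ hβ.posRepSys k := by
  rw [posRepSys_iff]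
  refine ⟨0, _, hβ.isPos_diagonal hr 0, ?_⟩
  rw [Matrix.diagonal_map (map_zero _)]
  simp only [map_smul]
  rfl

/-! ### States -/

/-- States are completely positive: `φ(G^* G)` is the sum over the rows of `G` of Gram matrices. -/
lemma IsStateRepSys.posSemidef {φ : hβ.RepSys →ₗ[ℂ] ℂ} (h : hβ.IsStateRepSys φ)
    {X : Matrix (Fin k) (Fin k) hβ.RepSys} (hX : X ∈ hβ.posRepSys k) : (X.map φ).PosSemidef := by
  obtain ⟨n, G, rfl⟩ := hX
  have key : ((G.conjTranspose * G).map (hβ.toRepSys n)).map φ =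
      ∑ a, Matrix.of fun i j => (φ ∘ₗ hβ.toRepSys n) (star (G a i) * G a j) := by
    ext i j
    simp only [Matrix.map_apply, Matrix.mul_apply, Matrix.conjTranspose_apply, map_sum,
      Matrix.sum_apply, Matrix.of_apply, LinearMap.comp_apply]
  rw [key]
  refine Matrix.posSemidef_sum _ fun a _ => posSemidef_gram _ (fun x => ?_) (fun x => ?_) _
  · rw [LinearMap.comp_apply, ← starRepSys_toRepSys, IsStateRepSys.map_star hβ h]; rfl
  · exact IsStateRepSys.nonneg hβ h n x

lemma mem_archKer {x : hβ.RepSys} :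
    x ∈ hβ.archKer ↔ ∀ φ : hβ.RepSys →ₗ[ℂ] ℂ, hβ.IsStateRepSys φ → φ x = 0 := by
  simp only [archKer, Submodule.mem_iInf, LinearMap.mem_ker]

lemma IsStateRepSys.eq_of_q_eq {φ : hβ.RepSys →ₗ[ℂ] ℂ} (h : hβ.IsStateRepSys φ) {x y : hβ.RepSys}
    (hxy : hβ.q x = hβ.q y) : φ x = φ y := by
  have := hβ.mem_archKer.1 ((Submodule.Quotient.eq _).1 hxy) φ h
  rwa [map_sub, sub_eq_zero] at this

/-- The inclusions and the states `τ_z` are contractive; the uniform bound provides the compactness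
for limits along an ultrafilter. -/
lemma norm_ev_Θ_le {m n : ℕ} (h : m ≤ n) (f : S.Zc m) (C : ℝ) (hC : ∀ z, ‖hβ.ev m z f‖ ≤ C)
    (z : (S.A n).Z) : ‖hβ.ev n z (hβ.Θ m n h f)‖ ≤ C := by
  have hC0 : 0 ≤ C := (norm_nonneg _).trans (hC (Classical.arbitrary _))
  induction n, h using Nat.le_induction with
  | base => rw [Θ_self, LinearMap.id_apply]; exact hC z
  | succ n h ih =>
    rw [hβ.Θ_succ m n h]
    change ‖hβ.ev (n + 1) z (hβ.E (n + 1) (S.incl n ((S.A n).centerIncl (hβ.Θ m n h f))))‖ ≤ C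
    rw [ev_E]
    refine ((hβ.τ_spec _ z).2.1.norm_le _).trans ((norm_comp_le _ _).trans ?_)
    refine (NonUnitalStarAlgHom.norm_apply_le (S.incl n) _).trans ?_
    refine lp.norm_le_of_forall_le hC0 fun w => ?_
    change ‖comp w ((S.A n).centerIncl (hβ.Θ m n h f))‖ ≤ C
    rw [hβ.comp_centerIncl, norm_smul, norm_one, mul_one]
    exact ih w

lemma Θ_one {m n : ℕ} (h : m ≤ n) : hβ.Θ m n h 1 = 1 := by
  induction n, h using Nat.le_induction with
  | base => rw [Θ_self, LinearMap.id_apply]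
  | succ n h ih =>
    rw [hβ.Θ_succ m n h, ih]
    change hβ.E (n + 1) (S.incl n ((S.A n).centerIncl 1)) = 1
    rw [map_one, map_one, E_one]

/-- The inductive limit `S̈(α, β)` has a state: a limit of evaluations along an ultrafilter. -/
lemma exists_isStateRepSys (L : S.LeftMult) : ∃ φ : hβ.RepSys →ₗ[ℂ] ℂ, hβ.IsStateRepSys φ := by
  let z : ∀ n, (S.A n).Z := fun n => Classical.arbitrary _
  let U : Ultrafilter ℕ := Filter.hyperfilter ℕ
  have hU : ∀ n, ∀ᶠ k in (U : Filter ℕ), n ≤ k := fun n =>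
    (Nat.hyperfilter_le_atTop) (Filter.eventually_ge_atTop n)
  -- The value `0` for `k < n` has no influence, since the ultrafilter contains every tail of `ℕ`.
  let a : ∀ n, S.Zc n → ℕ → ℂ := fun n f k =>
    if h : n ≤ k then hβ.ev k (z k) (hβ.Θ n k h f) else 0
  have ha : ∀ n f k (h : n ≤ k), a n f k = hβ.ev k (z k) (hβ.Θ n k h f) := fun n f k h => dif_pos h
  have hlim : ∀ n f, ∃ c, Filter.Tendsto (a n f) U (nhds c) := by
    intro n f
    have h1 : ∀ᶠ k in (U : Filter ℕ), a n f k ∈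
        Metric.closedBall (0 : ℂ) ‖(S.A n).centerIncl f‖ := by
      filter_upwards [hU n] with k hk
      rw [ha _ _ _ hk, mem_closedBall_zero_iff]
      exact hβ.norm_ev_Θ_le hk f _ (fun z => hβ.norm_ev_le n z f) _
    obtain ⟨c, -, hc⟩ := (isCompact_closedBall (0 : ℂ) ‖(S.A n).centerIncl f‖).ultrafilter_le_nhds
      (U.map (a n f)) (Filter.le_principal_iff.2 h1)
    exact ⟨c, hc⟩
  choose ω hω using hlim
  have hωe : ∀ n f c, (∀ᶠ k in (U : Filter ℕ), a n f k = c k) → Filter.Tendsto c U (nhds (ω n f)) :=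
    fun n f c h => (hω n f).congr' h
  have hlin : ∀ n, ∃ φ : S.Zc n →ₗ[ℂ] ℂ, ∀ f, φ f = ω n f := by
    intro n
    refine ⟨⟨⟨ω n, fun f g => ?_⟩, fun c f => ?_⟩, fun _ => rfl⟩
    · refine tendsto_nhds_unique (hωe n (f + g) _ ?_) ((hω n f).add (hω n g))
      filter_upwards [hU n] with k hk
      simp only [ha _ _ _ hk, map_add]
    · refine tendsto_nhds_unique (hωe n (c • f) _ ?_) ((hω n f).const_mul c)
      filter_upwards [hU n] with k hk
      simp only [ha _ _ _ hk, map_smul, smul_eq_mul]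
  choose φ hφ using hlin
  have hΘ : ∀ m n h f, φ n (hβ.Θ m n h f) = φ m f := by
    intro m n h f
    rw [hφ, hφ]
    refine tendsto_nhds_unique (hωe n _ (a m f) ?_) (hω m f)
    filter_upwards [hU n] with k hk
    rw [ha _ _ _ hk, ha _ _ _ (h.trans hk)]
    congr 1
    induction k, hk using Nat.le_induction with
    | base => rw [Θ_self, LinearMap.id_apply]
    | succ k hk ih => rw [hβ.Θ_succ n k hk, ih, hβ.Θ_succ m k (h.trans hk)]
  refine ⟨hβ.liftRepSys φ hΘ, ?_, fun X hX => ?_⟩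
  · rw [unitRepSys, hβ.liftRepSys_toRepSys, hφ]
    refine tendsto_nhds_unique (hωe 0 1 (fun _ => 1) ?_) tendsto_const_nhds
    exact Filter.Eventually.of_forall fun k => by rw [ha _ _ _ k.zero_le, Θ_one, ev_one]
  · rw [posRepSys_iff] at hX
    obtain ⟨n, P, hP, rfl⟩ := hX
    rw [Matrix.map_apply, hβ.liftRepSys_toRepSys, hφ]
    refine ge_of_tendsto (hω n _) ?_
    filter_upwards [hU n] with k hk
    rw [ha _ _ _ hk]
    exact (L.isPos_map_Θ hβ hk hP (z k)).diag_nonneg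

end Admissible

end FlowSequence

namespace FlowSequence

open AtomicAlg

variable {S : FlowSequence.{u, v}} {β : ℝ}

namespace LeftMult

variable {L : S.LeftMult} (hβ : S.Admissible β)

/-! ### The multiplication of `S(α, β)` -/

/-- Multiplication by positive elements of `𝒵(A m)` preserves the common kernel of the states. -/
lemma mulRepSys_star_mul_self_mem_archKer (hc : L.PropertyC) (m : ℕ) (f : S.Zc m)
    {x : hβ.RepSys} (hx : x ∈ hβ.archKer) :
    mulRepSys hβ hc (hβ.toRepSys m (star f * f)) x ∈ hβ.archKer := by
  rw [Admissible.mem_archKer]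
  intro φ hφ
  have hf : ∀ m (f : S.Zc m), (Matrix.of fun _ _ => hβ.toRepSys m (star f * f)) ∈
      hβ.posRepSys 1 := fun m f =>
    ⟨m, Matrix.of fun _ _ => f, by ext i j; simp [Matrix.mul_apply]⟩
  have hpos : ∀ X ∈ hβ.posRepSys 1,
      0 ≤ φ (mulRepSys hβ hc (hβ.toRepSys m (star f * f)) (X 0 0)) :=
    fun X hX => hφ.2 _ (posRepSys_schur hβ hc (hf m f) hX)
  have h0 : 0 ≤ φ (mulRepSys hβ hc (hβ.toRepSys m (star f * f)) hβ.unitRepSys) := by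
    have := hpos _ (hf 0 1)
    rwa [Matrix.of_apply, star_one, one_mul] at this
  set ψ : hβ.RepSys →ₗ[ℂ] ℂ := φ ∘ₗ mulRepSys hβ hc (hβ.toRepSys m (star f * f)) with hψ
  change 0 ≤ ψ hβ.unitRepSys at h0
  obtain ⟨r, hr, hr'⟩ : ∃ r : ℝ, 0 ≤ r ∧ ψ hβ.unitRepSys = r := by
    rw [Complex.le_def] at h0
    exact ⟨(ψ hβ.unitRepSys).re, h0.1, Complex.ext rfl h0.2.symm⟩
  have hr0 : ((r + 1 : ℝ) : ℂ) ≠ 0 := by exact_mod_cast (by positivity : (r + 1 : ℝ) ≠ 0)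
  have hri : 0 ≤ ((r + 1 : ℝ) : ℂ)⁻¹ := by exact_mod_cast (by positivity : 0 ≤ (r + 1 : ℝ)⁻¹)
  -- The normalized sum `ψ + φ` is a state even if `ψ` vanishes. Both it and `φ` kill `x`, hence so
  -- does `ψ`.
  have hst : hβ.IsStateRepSys (((r + 1 : ℝ) : ℂ)⁻¹ • (ψ + φ)) := by
    refine ⟨?_, fun X hX => mul_nonneg hri (add_nonneg (hpos X hX) (hφ.2 X hX))⟩
    rw [LinearMap.smul_apply, LinearMap.add_apply, hr', hφ.1, smul_eq_mul, ← Complex.ofReal_one,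
      ← Complex.ofReal_add, Complex.ofReal_one, inv_mul_cancel₀ hr0]
  have h1 := hβ.mem_archKer.1 hx _ hst
  rw [LinearMap.smul_apply, LinearMap.add_apply, hβ.mem_archKer.1 hx φ hφ, add_zero, smul_eq_mul,
    mul_eq_zero] at h1
  exact h1.resolve_left (inv_ne_zero hr0)

/-- By polarization the elements `d^* d` span `𝒵(A m)`, so the kernel is an ideal. -/
lemma mulRepSys_mem_archKer (hc : L.PropertyC) (y : hβ.RepSys) {x : hβ.RepSys}
    (hx : x ∈ hβ.archKer) : mulRepSys hβ hc y x ∈ hβ.archKer := by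
  obtain ⟨m, f, rfl⟩ := hβ.exists_toRepSys y
  rw [polarization_one f]
  have h := fun f => mulRepSys_star_mul_self_mem_archKer hβ hc m f hx
  simp only [map_smul, map_sub, LinearMap.smul_apply, LinearMap.sub_apply]
  exact Submodule.smul_mem _ _ (sub_mem (sub_mem (h _) (h _))
    (Submodule.smul_mem _ _ (sub_mem (h _) (h _))))

/-- Multiplication `S̈(α, β) × S(α, β) → S(α, β)`. -/
def mulQuot (hc : L.PropertyC) : hβ.RepSys →ₗ[ℂ] hβ.RepOpSys →ₗ[ℂ] hβ.RepOpSys :=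
  (hβ.archKer.liftQ ((mulRepSys hβ hc).compr₂ hβ.q).flip fun _ hx => LinearMap.ext fun y =>
    (Submodule.Quotient.mk_eq_zero _).2 (mulRepSys_mem_archKer hβ hc y hx)).flip

/-- The multiplication of `S(α, β)`. -/
def mulRepOpSys (hc : L.PropertyC) : hβ.RepOpSys →ₗ[ℂ] hβ.RepOpSys →ₗ[ℂ] hβ.RepOpSys :=
  hβ.archKer.liftQ (mulQuot hβ hc) fun x hx => LinearMap.ext fun y => by
    obtain ⟨y, rfl⟩ := Submodule.Quotient.mk_surjective _ y
    refine (Submodule.Quotient.mk_eq_zero _).2 ?_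
    rw [(isUnitalCommAlgebra_mulRepSys hβ hc).mul_comm]
    exact mulRepSys_mem_archKer hβ hc y hx

lemma mulRepOpSys_q (hc : L.PropertyC) (x y : hβ.RepSys) :
    mulRepOpSys hβ hc (hβ.q x) (hβ.q y) = hβ.q (mulRepSys hβ hc x y) := rfl

lemma q_surjective : Function.Surjective hβ.q := Submodule.mkQ_surjective _

lemma isUnitalCommAlgebra_mulRepOpSys (hc : L.PropertyC) :
    IsUnitalCommAlgebra (mulRepOpSys hβ hc) hβ.unitRepOpSys where
  mul_assoc x y z := by
    obtain ⟨x, rfl⟩ := q_surjective hβ x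
    obtain ⟨y, rfl⟩ := q_surjective hβ y
    obtain ⟨z, rfl⟩ := q_surjective hβ z
    simp only [mulRepOpSys_q, (isUnitalCommAlgebra_mulRepSys hβ hc).mul_assoc]
  mul_comm x y := by
    obtain ⟨x, rfl⟩ := q_surjective hβ x
    obtain ⟨y, rfl⟩ := q_surjective hβ y
    rw [mulRepOpSys_q, mulRepOpSys_q, (isUnitalCommAlgebra_mulRepSys hβ hc).mul_comm]
  one_mul x := by
    obtain ⟨x, rfl⟩ := q_surjective hβ x
    rw [Admissible.unitRepOpSys, mulRepOpSys_q, (isUnitalCommAlgebra_mulRepSys hβ hc).one_mul]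

lemma isSurjAlgHom_q_projRepSys (hc : L.PropertyC) :
    IsSurjAlgHom (L.mulDSum hβ) (S.oneDSum 0) (mulRepOpSys hβ hc) hβ.unitRepOpSys
      (hβ.q ∘ₗ projRepSys hβ) where
  map_mul x y := by
    simp only [LinearMap.comp_apply, mulRepOpSys_q, projRepSys_mul hβ hc]
  map_one := congrArg hβ.q (projRepSys_toDSum hβ 0 1)
  surjective := (q_surjective hβ).comp (projRepSys_surjective hβ)

/-- Both `E` and `ι` respect the involution. This is what keeps the lower left corner right in the
Schur product of norm matrices. -/
lemma starRepSys_mulRepSys (hc : L.PropertyC) (x y : hβ.RepSys) :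
    hβ.starRepSys (mulRepSys hβ hc x y) =
      mulRepSys hβ hc (hβ.starRepSys x) (hβ.starRepSys y) := by
  obtain ⟨m, f, rfl⟩ := hβ.exists_toRepSys x
  obtain ⟨n, g, rfl⟩ := hβ.exists_toRepSys y
  rw [mulRepSys_toRepSys hβ hc rfl, hβ.starRepSys_toRepSys, hβ.starRepSys_toRepSys,
    hβ.starRepSys_toRepSys, mulRepSys_toRepSys hβ hc rfl, pr, pr, ← hβ.E_star, ← tm_star,
    map_star, map_star]

/-! ### The norm of `S(α, β)` -/

/-- The matrix `[[r e, s], [s^*, r e]]`. -/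
def normMatrix (r : ℝ) (s : hβ.RepOpSys) : Matrix (Fin 2) (Fin 2) hβ.RepOpSys :=
  !![(r : ℂ) • hβ.unitRepOpSys, s; hβ.starRepOpSys s, (r : ℂ) • hβ.unitRepOpSys]

lemma starRepOpSys_q (x : hβ.RepSys) :
    hβ.starRepOpSys (hβ.q x) = hβ.q (hβ.starRepSys x) := rfl

lemma normMatrix_add_diagonal (r ε : ℝ) (s : hβ.RepOpSys) :
    normMatrix hβ r s + Matrix.diagonal (fun _ => (ε : ℂ) • hβ.unitRepOpSys) =
      normMatrix hβ (r + ε) s := by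
  ext i j
  fin_cases i <;> fin_cases j <;> simp [normMatrix, add_smul]

lemma normMatrix_add (r r' : ℝ) (s s' : hβ.RepOpSys) :
    normMatrix hβ r s + normMatrix hβ r' s' = normMatrix hβ (r + r') (s + s') := by
  ext i j
  fin_cases i <;> fin_cases j <;> simp [normMatrix, add_smul]

lemma normMatrix_schur (hc : L.PropertyC) (r r' : ℝ) (s s' : hβ.RepOpSys) :
    (Matrix.of fun i j => mulRepOpSys hβ hc (normMatrix hβ r s i j) (normMatrix hβ r' s' i j)) =
      normMatrix hβ (r * r') (mulRepOpSys hβ hc s s') := by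
  have h1 := (isUnitalCommAlgebra_mulRepOpSys hβ hc).one_mul
  have h2 : mulRepOpSys hβ hc (hβ.starRepOpSys s) (hβ.starRepOpSys s') =
      hβ.starRepOpSys (mulRepOpSys hβ hc s s') := by
    obtain ⟨s, rfl⟩ := q_surjective hβ s
    obtain ⟨s', rfl⟩ := q_surjective hβ s'
    rw [mulRepOpSys_q, starRepOpSys_q, starRepOpSys_q, starRepOpSys_q, mulRepOpSys_q,
      starRepSys_mulRepSys]
  ext i j
  fin_cases i <;> fin_cases j <;>
    simp [normMatrix, h1, h2, smul_smul, mul_comm, -Complex.coe_smul]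

/-- The set whose infimum is the norm. -/
def normSet (s : hβ.RepOpSys) : Set ℝ := {r | 0 < r ∧ normMatrix hβ r s ∈ hβ.posRepOpSys 2}

lemma mem_normSet {s : hβ.RepOpSys} {r : ℝ} : r ∈ normSet hβ s ↔ 0 < r ∧
    ∀ ε : ℝ, 0 < ε → ∃ Y ∈ hβ.posRepSys 2, normMatrix hβ (r + ε) s = Y.map hβ.q := by
  refine and_congr_right fun _ => forall₂_congr fun ε _ => ?_
  rw [normMatrix_add_diagonal]

lemma bddBelow_normSet (s : hβ.RepOpSys) : BddBelow (normSet hβ s) := ⟨0, fun _ h => h.1.le⟩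

lemma normRepOpSys_le {s : hβ.RepOpSys} {r : ℝ} (h : r ∈ normSet hβ s) :
    hβ.normRepOpSys s ≤ r := csInf_le (bddBelow_normSet hβ s) h

/-- The operator system norm is dominated by the supremum of the values, because the scalar matrices
`[[C, c], [c̄, C]]` with `|c| ≤ C` are positive. -/
lemma mem_normSet_toRepOpSys {n : ℕ} {f : S.Zc n} {C : ℝ} (hC : 0 < C)
    (h : ∀ z, ‖hβ.ev n z f‖ ≤ C) : C ∈ normSet hβ (hβ.toRepOpSys n f) := by
  rw [mem_normSet]
  refine ⟨hC, fun ε hε => ⟨_, hβ.posRepSys_iff.2 ⟨n, _, hβ.isPos_two (C := C + ε) fun z =>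
    (h z).trans (by linarith), rfl⟩, ?_⟩⟩
  have hu : hβ.q (hβ.toRepSys n 1) = hβ.unitRepOpSys := by
    rw [← hβ.Θ_one n.zero_le, hβ.toRepSys_Θ]; rfl
  ext i j
  fin_cases i <;> fin_cases j
  · simp [normMatrix, hu]
  · rfl
  · simp only [normMatrix, Admissible.toRepOpSys, LinearMap.comp_apply, starRepOpSys_q,
      hβ.starRepSys_toRepSys]
    rfl
  · simp [normMatrix, hu]

lemma normSet_nonempty (s : hβ.RepOpSys) : (normSet hβ s).Nonempty := by
  obtain ⟨x, rfl⟩ := q_surjective hβ s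
  obtain ⟨n, f, rfl⟩ := hβ.exists_toRepSys x
  exact ⟨‖(S.A n).centerIncl f‖ + 1, mem_normSet_toRepOpSys hβ (by positivity) fun z =>
    (hβ.norm_ev_le n z f).trans (by linarith)⟩

lemma exists_mem_normSet_lt {s : hβ.RepOpSys} {a : ℝ}
    (h : hβ.normRepOpSys s < a) : ∃ r ∈ normSet hβ s, r < a :=
  exists_lt_of_csInf_lt (normSet_nonempty hβ s) h

lemma normRepOpSys_nonneg (s : hβ.RepOpSys) : 0 ≤ hβ.normRepOpSys s :=
  Real.sInf_nonneg fun _ h => h.1.le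

lemma add_mem_normSet (L : S.LeftMult) {s s' : hβ.RepOpSys} {r r' : ℝ} (h : r ∈ normSet hβ s)
    (h' : r' ∈ normSet hβ s') : r + r' ∈ normSet hβ (s + s') := by
  rw [mem_normSet] at *
  refine ⟨add_pos h.1 h'.1, fun ε hε => ?_⟩
  obtain ⟨Y, hY, e⟩ := h.2 (ε / 2) (by positivity)
  obtain ⟨Y', hY', e'⟩ := h'.2 (ε / 2) (by positivity)
  refine ⟨Y + Y', L.posRepSys_add hβ hY hY', ?_⟩
  rw [Matrix.map_add _ (map_add _), ← e, ← e', normMatrix_add]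
  congr 1
  ring

lemma mul_mem_normSet (hc : L.PropertyC) {s s' : hβ.RepOpSys} {r r' : ℝ} (h : r ∈ normSet hβ s)
    (h' : r' ∈ normSet hβ s') : r * r' ∈ normSet hβ (mulRepOpSys hβ hc s s') := by
  rw [mem_normSet] at *
  refine ⟨mul_pos h.1 h'.1, fun δ hδ => ?_⟩
  have hr := h.1
  have hr' := h'.1
  -- As `ε ≤ 1`, the excess `(r + ε)(r' + ε) - r r' = ε (r + r' + ε)` is at most `δ`. The rest is
  -- made up by a nonnegative multiple of the unit on the diagonal.
  set ε := min 1 (δ / (r + r' + 1)) with hε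
  have hε0 : 0 < ε := lt_min one_pos (by positivity)
  have hε1 : ε ≤ 1 := min_le_left _ _
  have hε2 : ε * (r + r' + 1) ≤ δ := (le_div_iff₀ (by positivity)).1 (min_le_right _ _)
  obtain ⟨Y, hY, e⟩ := h.2 ε hε0
  obtain ⟨Y', hY', e'⟩ := h'.2 ε hε0
  have hd : 0 ≤ r * r' + δ - (r + ε) * (r' + ε) := by nlinarith
  refine ⟨_, L.posRepSys_add hβ (posRepSys_schur hβ hc hY hY') (hβ.diagonal_mem_posRepSys hd), ?_⟩
  have e1 : (Matrix.of fun i j => mulRepSys hβ hc (Y i j) (Y' i j)).map hβ.q =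
      normMatrix hβ ((r + ε) * (r' + ε)) (mulRepOpSys hβ hc s s') := by
    rw [← normMatrix_schur, e, e']
    rfl
  have e2 : (Matrix.diagonal fun _ : Fin 2 => ((r * r' + δ - (r + ε) * (r' + ε) : ℝ) : ℂ) •
      hβ.unitRepSys).map hβ.q = Matrix.diagonal fun _ =>
        ((r * r' + δ - (r + ε) * (r' + ε) : ℝ) : ℂ) • hβ.unitRepOpSys := by
    rw [Matrix.diagonal_map (map_zero _)]
    simp only [map_smul]
    rfl
  rw [Matrix.map_add _ (map_add _), e1, e2, normMatrix_add_diagonal]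
  congr 1
  ring

lemma norm_state_le {φ : hβ.RepSys →ₗ[ℂ] ℂ} (hφ : hβ.IsStateRepSys φ) {x : hβ.RepSys} {r : ℝ}
    (h : r ∈ normSet hβ (hβ.q x)) : ‖φ x‖ ≤ r := by
  rw [mem_normSet] at h
  refine le_of_forall_pos_le_add fun ε hε => ?_
  obtain ⟨Y, hY, e⟩ := h.2 ε hε
  have hp := hφ.posSemidef hβ hY
  have hY' : ∀ i j, normMatrix hβ (r + ε) (hβ.q x) i j = hβ.q (Y i j) := fun i j => by rw [e]; rfl
  have hu : (((r + ε : ℝ) : ℂ)) = φ (((r + ε : ℝ) : ℂ) • hβ.unitRepSys) := by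
    rw [map_smul, hφ.1, smul_eq_mul, mul_one]
  have h00 : φ (Y 0 0) = ((r + ε : ℝ) : ℂ) := by
    rw [hu]; exact (hφ.eq_of_q_eq hβ (hY' 0 0)).symm
  have h11 : φ (Y 1 1) = ((r + ε : ℝ) : ℂ) := by
    rw [hu]; exact (hφ.eq_of_q_eq hβ (hY' 1 1)).symm
  have h01 : φ (Y 0 1) = φ x := (hφ.eq_of_q_eq hβ (hY' 0 1)).symm
  have h10 : φ (Y 1 0) = star (φ x) := by
    rw [← Admissible.IsStateRepSys.map_star hβ hφ]
    exact (hφ.eq_of_q_eq hβ (hY' 1 0)).symm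
  -- Complete positivity of `φ` and the `2 × 2` determinant give `|φ(x)|² ≤ (r + ε)²`.
  have hdet := hp.det_nonneg
  rw [Matrix.det_fin_two] at hdet
  simp only [Matrix.map_apply, h00, h11, h01, h10] at hdet
  rw [Complex.star_def, Complex.mul_conj, Complex.normSq_eq_norm_sq] at hdet
  have h2 : 0 ≤ (r + ε) * (r + ε) - ‖φ x‖ ^ 2 := by exact_mod_cast hdet
  have h3 := h.1
  exact abs_le_of_sq_le_sq' (by nlinarith) (by linarith) |>.2

lemma norm_state_le_norm {φ : hβ.RepSys →ₗ[ℂ] ℂ} (hφ : hβ.IsStateRepSys φ)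
    (x : hβ.RepSys) : ‖φ x‖ ≤ hβ.normRepOpSys (hβ.q x) :=
  le_csInf (normSet_nonempty hβ _) fun _ h => norm_state_le hβ hφ h

lemma normRepOpSys_mul_le (hc : L.PropertyC) (s s' : hβ.RepOpSys) :
    hβ.normRepOpSys (mulRepOpSys hβ hc s s') ≤ hβ.normRepOpSys s * hβ.normRepOpSys s' := by
  refine le_mul_of_forall_lt₀ fun a ha b hb => ?_
  obtain ⟨r, hr, h⟩ := exists_mem_normSet_lt hβ ha
  obtain ⟨r', hr', h'⟩ := exists_mem_normSet_lt hβ hb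
  exact (normRepOpSys_le hβ (mul_mem_normSet hβ hc hr hr')).trans
    (mul_le_mul h.le h'.le hr'.1.le (hr.1.le.trans h.le))

/-- Scalar multiplication is multiplication by `c e`, so submultiplicativity reduces the claim to
`‖c e‖ ≤ |c|`. -/
lemma normRepOpSys_smul_le (hc : L.PropertyC) (c : ℂ) (s : hβ.RepOpSys) :
    hβ.normRepOpSys (c • s) ≤ ‖c‖ * hβ.normRepOpSys s := by
  have h1 : hβ.normRepOpSys (c • hβ.unitRepOpSys) ≤ ‖c‖ := by
    refine le_of_forall_pos_le_add fun ε hε => normRepOpSys_le hβ ?_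
    have : c • hβ.unitRepOpSys = hβ.toRepOpSys 0 (c • 1) := by rw [map_smul]; rfl
    rw [this]
    refine mem_normSet_toRepOpSys hβ (by positivity) fun z => ?_
    rw [map_smul, Admissible.ev_one, smul_eq_mul, mul_one]
    linarith
  have h2 : c • s = mulRepOpSys hβ hc (c • hβ.unitRepOpSys) s := by
    rw [map_smul, LinearMap.smul_apply, (isUnitalCommAlgebra_mulRepOpSys hβ hc).one_mul]
  rw [h2]
  exact (normRepOpSys_mul_le hβ hc _ _).trans
    (mul_le_mul_of_nonneg_right h1 (normRepOpSys_nonneg hβ s))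

lemma isAlgebraNorm_normRepOpSys (hc : L.PropertyC) :
    IsAlgebraNorm (mulRepOpSys hβ hc) hβ.unitRepOpSys hβ.normRepOpSys where
  nonneg := normRepOpSys_nonneg hβ
  eq_zero_iff s := by
    constructor
    · intro h
      obtain ⟨x, rfl⟩ := q_surjective hβ s
      -- Norm zero forces every state to vanish at `x`, which is membership in the kernel divided
      -- out.
      refine (Submodule.Quotient.mk_eq_zero _).2 (hβ.mem_archKer.2 fun φ hφ => ?_)
      exact norm_le_zero_iff.1 ((norm_state_le_norm hβ hφ x).trans_eq h)
    · rintro rfl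
      have := normRepOpSys_smul_le hβ hc 0 0
      rw [norm_zero, zero_mul, smul_zero] at this
      exact le_antisymm this (normRepOpSys_nonneg hβ 0)
  add_le s s' := by
    refine le_of_forall_pos_le_add fun ε hε => ?_
    obtain ⟨r, hr, h⟩ := exists_mem_normSet_lt hβ (lt_add_of_pos_right (hβ.normRepOpSys s)
      (half_pos hε))
    obtain ⟨r', hr', h'⟩ := exists_mem_normSet_lt hβ (lt_add_of_pos_right (hβ.normRepOpSys s')
      (half_pos hε))
    have := normRepOpSys_le hβ (add_mem_normSet hβ L hr hr')
    linarith
  smul c s := by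
    refine le_antisymm (normRepOpSys_smul_le hβ hc c s) ?_
    rcases eq_or_ne c 0 with rfl | h
    · rw [norm_zero, zero_mul]
      exact normRepOpSys_nonneg hβ _
    · have := normRepOpSys_smul_le hβ hc c⁻¹ (c • s)
      rwa [smul_smul, inv_mul_cancel₀ h, one_smul, norm_inv, inv_mul_eq_div,
        le_div_iff₀' (norm_pos_iff.2 h)] at this
  mul_le := normRepOpSys_mul_le hβ hc
  norm_one := by
    refine le_antisymm (normRepOpSys_le hβ ?_) ?_
    · exact mem_normSet_toRepOpSys hβ (n := 0) (f := 1) one_pos fun z => by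
        rw [Admissible.ev_one, norm_one]
    -- The bound `1 ≤ ‖e‖` needs an actual state; without one the quotient would be zero.
    · obtain ⟨φ, hφ⟩ := hβ.exists_isStateRepSys L
      have := norm_state_le_norm hβ hφ hβ.unitRepSys
      rwa [hφ.1, norm_one] at this

end LeftMult

end FlowSequence

end RepSystem

end

open RepSystem

theorem proposition3p16 (S : FlowSequence.{u, v}) (β : ℝ) (hβ : S.Admissible β)
    (L : S.LeftMult) (hc : L.PropertyC) :
    -- `Σ(α, β)` is a unital commutative algebra with unit `1_0`
    IsUnitalCommAlgebra (L.mulDSum hβ) (S.oneDSum 0) ∧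
    -- the left actions of `Σ(α, β)` on `S̈(α, β)` and on `S(α, β)`
    ∃ (act₁ : S.DSum →ₗ[ℂ] hβ.RepSys →ₗ[ℂ] hβ.RepSys)
      (act₂ : S.DSum →ₗ[ℂ] hβ.RepOpSys →ₗ[ℂ] hβ.RepOpSys),
      L.IsLeftAction hβ hβ.toRepSys act₁ ∧ L.IsLeftAction hβ hβ.toRepOpSys act₂ ∧
      -- the multiplications of `S̈(α, β)` and of `S(α, β)`
      ∃ (mul₁ : hβ.RepSys →ₗ[ℂ] hβ.RepSys →ₗ[ℂ] hβ.RepSys)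
        (mul₂ : hβ.RepOpSys →ₗ[ℂ] hβ.RepOpSys →ₗ[ℂ] hβ.RepOpSys),
        IsUnitalCommAlgebra mul₁ hβ.unitRepSys ∧
        IsUnitalCommAlgebra mul₂ hβ.unitRepOpSys ∧
        IsSurjAlgHom (L.mulDSum hβ) (S.oneDSum 0) mul₁ hβ.unitRepSys
          (act₁.flip hβ.unitRepSys) ∧
        IsSurjAlgHom (L.mulDSum hβ) (S.oneDSum 0) mul₂ hβ.unitRepOpSys
          (act₂.flip hβ.unitRepOpSys) ∧
        IsAlgebraNorm mul₂ hβ.unitRepOpSys hβ.normRepOpSys := by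
  have h₁ := FlowSequence.LeftMult.isUnitalCommAlgebra_mulRepSys hβ hc
  have h₂ := FlowSequence.LeftMult.isUnitalCommAlgebra_mulRepOpSys hβ hc
  obtain ⟨ha₁, hs₁⟩ := FlowSequence.LeftMult.isLeftAction_of_surj hβ h₁
    (FlowSequence.LeftMult.isSurjAlgHom_projRepSys hβ hc)
    (FlowSequence.LeftMult.projRepSys_toDSum hβ)
  obtain ⟨ha₂, hs₂⟩ := FlowSequence.LeftMult.isLeftAction_of_surj hβ h₂
    (FlowSequence.LeftMult.isSurjAlgHom_q_projRepSys hβ hc) (T := hβ.toRepOpSys)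
    fun n f => congrArg hβ.q (FlowSequence.LeftMult.projRepSys_toDSum hβ n f)
  exact ⟨hc.isUnitalCommAlgebra_mulDSum hβ, _, _, ha₁, ha₂, _, _, h₁, h₂, hs₁, hs₂,
    FlowSequence.LeftMult.isAlgebraNorm_normRepOpSys hβ hc⟩
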